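/- **Setting.** Let $d\ge 1$, $A\in\mathbb R^{n\times n}$, $B\in\mathbb R^{n\times m}$, and let $Q\succ0$, $R\succ0$ be symmetric. Let $S_x[k]\in\{0,1\}^{n\times n}$ and $S_u[k]\in\{0,1\}^{m\times n}$ $(k\ge1)$ be binary sparsity patterns with $S_x[k]=S_x[d]$ and $S_u[k]=S_u[d]$ for all $k\ge d$ ($d$-delayed localization constraints; for instance $S[k]=\mathrm{Sp}(\mathbb A^{\min(k,d)})$, where $\mathbb A=\mathrm{Sp}(A)$ is the $0$-$1$ support matrix of $A$). For a column $i$ write $s_x[k]$, $s_u[k]$ for the $i$-th columns of $S_x[k]$, $S_u[k]$, and write $v\in s$ if the vector $v$ vanishes wherever $s$ is $0$. A transfer matrix $\mathbf G(z)=\sum_{k\ge0}z^{-k}G[k]$ is in $\mathcal{RH}_\infty$ if it is real rational, proper, and has all its poles in the open unit disc; $\|\mathbf G\|_{\mathcal H_2}=(\sum_k\|G[k]\|_F^2)^{1/2}$. The state-feedback SLS problem is $$\min_{\mathbf\Phi_x,\mathbf\Phi_u\in\frac1z\mathcal{RH}_\infty}\left\|\begin{bmatrix}Q^{1/2}\mathbf\Phi_x\\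 R^{1/2}\mathbf\Phi_u\end{bmatrix}\right\|_{\mathcal H_2}\quad\text{s.t. } (zI-A)\mathbf\Phi_x-B\mathbf\Phi_u=I,$$ and, for all $k\ge1$ and all $i$, the $i$-th columns of $\Phi_x[k]$ and $\Phi_u[k]$ are in $s_x[k]$ and $s_u[k]$. The constraints are assumed feasible in the following sense: for every column $i$, $e_i\in s_x[1]$, and for every $k\ge1$ and every $\xi\in s_x[k]$ there are square-summable sequences $(x_t)_{t\ge0}$, $(u_t)_{t\ge0}$ with $x_0=\xi$, $x_{t+1}=Ax_t+Bu_t$, $x_t\in s_x[k+t]$, $u_t\in s_u[k+t]$ for all $t\geq 0$. **Sparsity-reduced data.** For a column $i$ and a step $k$, let $M_u[k]$ have as columns the standard basis vectors of the positions in $s_u[k]$, let $M_x[k]$ have as rows those of the positions *not* in $s_x[k]$, and set $F[k]=M_x[k+1]BM_u[k]$, with Moore–Penrose inverse $F[k]^\dagger$. Let $N[k]$ be any matrix mapping some $\mathbb R^{r}$ bijectively onto $\ker F[k]$. Put $U=M_u[k]N[k]$ and $$\kappa[k]=M_u[k]F[k]^\dagger M_x[k+1]A,\quad \tilde A=A-B\kappa,\quad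 \tilde B=BU,\quad \tilde Q=Q+\kappa^{\mathsf T}R\kappa,\quad \tilde Z=-U^{\mathsf T}R\kappa,\quad \tilde R=U^{\mathsf T}RU$$ (all at step $k$). For data $D=(\tilde A,\tilde B,\tilde Q,\tilde Z,\tilde R)$ let $$K_D(X)=(\tilde R+\tilde B^{\mathsf T}X\tilde B)^{-1}(\tilde B^{\mathsf T}X\tilde A+\tilde Z),$$ $$\mathrm{Ric}_D(X)=\tilde Q+\tilde A^{\mathsf T}X\tilde A-(\tilde A^{\mathsf T}X\tilde B+\tilde Z^{\mathsf T})(\tilde R+\tilde B^{\mathsf T}X\tilde B)^{-1}(\tilde B^{\mathsf T}X\tilde A+\tilde Z).$$ **Static problem.** Form the same data with $s_u[d]$ and $s_x[d]$ in place of $s_u[k]$ and $s_x[k+1]$, giving $\kappa_\star,U_\star,\tilde A_\star,\dots$, and express it in the coordinates of the vectors in $s_x[d]$: with $E$ the matrix whose columns are the standard basis vectors of the positions in $s_x[d]$, let $D_\star=(E^{\mathsf T}\tilde A_\star E,\,E^{\mathsf T}\tilde B_\star,\,E^{\mathsf T}\tilde Q_\star E,\,\tilde Z_\star E,\,\tilde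 R_\star)$. **Theorem.** 1. For every column $i$ the stationary Riccati equation $X=\mathrm{Ric}_{D_\star}(X)$ has exactly one positive definite solution $X_\star$. 2. For every column $i$, let $\tilde X[d+1]=EX_\star E^{\mathsf T}$ and, for $k=d,\dots,1$, $$\tilde X[k]=\mathrm{Ric}_{D[k]}(\tilde X[k+1]),\qquad \tilde K[k]=K_{D[k]}(\tilde X[k+1]),$$ $$A_{\rm CL}[k]=\tilde A[k]-\tilde B[k]\tilde K[k],\qquad K_{\rm CL}[k]=-(\kappa[k]+M_u[k]N[k]\tilde K[k]),$$ $$A_{{\rm CL},\star}=E\left(E^{\mathsf T}\tilde A_\star E-E^{\mathsf T}\tilde B_\star K_{D_\star}(X_\star)\right)E^{\mathsf T},\qquad K_{{\rm CL},\star}=-(\kappa_\star E+U_\star K_{D_\star}(X_\star))E^{\mathsf T}.$$ Let $A_{SF}^i$ be the $(d+1)\times(d+1)$ block matrix with blocks $A_{\rm CL}[1],\dots,A_{\rm CL}[d]$ on the first block subdiagonal, $A_{{\rm CL},\star}$ in the last diagonal position, and zeros elsewhere; let $B_{SF}^i=[e_i^{\mathsf T}\ 0\cdots0]^{\mathsf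 T}$, $C_{SF}^i=[I\ I\cdots I]$ and $K_{SF}^i=[K_{\rm CL}[1]\cdots K_{\rm CL}[d]\ K_{{\rm CL},\star}]$. Then the state-feedback SLS problem has exactly one minimizer $(\mathbf\Phi_x^\star,\mathbf\Phi_u^\star)$, and its columns are, for every $i$, $$\mathbf\Phi_x^\star(:,i)=C_{SF}^i(zI-A_{SF}^i)^{-1}B_{SF}^i,\qquad \mathbf\Phi_u^\star(:,i)=K_{SF}^i(zI-A_{SF}^i)^{-1}B_{SF}^i .$$ -/

import Mathlib

open Matrix
open scoped ENNReal MatrixOrder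

noncomputable section

/-! ### Transfer matrices -/

/-- A real rational transfer matrix in the variable `z`, which is `RatFunc.X`. -/
abbrev TransferMatrix (p q : Type) : Type := Matrix p q (RatFunc ℝ)

namespace TransferMatrix

variable {p q r s : Type}

/-- A real matrix viewed as a constant transfer matrix. -/
def const (M : Matrix p q ℝ) : TransferMatrix p q := M.map (fun a => RatFunc.C a)

/-- The matrix `z I - A`. -/
def zSub [Fintype s] [DecidableEq s] (A : Matrix s s ℝ) : TransferMatrix s s :=
  Matrix.scalar s (RatFunc.X : RatFunc ℝ) - const A

/-- The state-space realization `C (z I - A)⁻¹ B + D`. -/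
def ssreal [Fintype s] [DecidableEq s] (A : Matrix s s ℝ) (B : Matrix s q ℝ)
    (C : Matrix p s ℝ) (D : Matrix p q ℝ) : TransferMatrix p q :=
  const C * (zSub A)⁻¹ * const B + const D

/-- Scalar `RH∞`: proper rational functions all of whose (complex) poles lie in the open
unit disc. -/
def IsRHInfScalar (f : RatFunc ℝ) : Prop :=
  f.num.natDegree ≤ f.denom.natDegree ∧
    ∀ z : ℂ, Polynomial.aeval z f.denom = 0 → ‖z‖ < 1

/-- `RH∞`: proper, real rational, stable transfer matrices. -/
def IsRHInf (G : TransferMatrix p q) : Prop := ∀ a b, IsRHInfScalar (G a b)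

/-- `(1/z) RH∞`: those `G` with `z G ∈ RH∞`. -/
def IsInvZRHInf (G : TransferMatrix p q) : Prop :=
  IsRHInf ((RatFunc.X : RatFunc ℝ) • G)

/-- The coefficient of `z⁻ᵏ` in the expansion `f(z) = ∑ z⁻ᵏ f[k]` at infinity. The Laurent series
variable is `1/z`, so `z` is the monomial of degree `-1`. -/
def kernelScalar (f : RatFunc ℝ) (k : ℤ) : ℝ :=
  (RatFunc.eval (HahnSeries.C : ℝ →+* LaurentSeries ℝ) (HahnSeries.single (-1 : ℤ) (1 : ℝ)) f).coeff k

/-- The convolution kernel `G[k]` of `G(z) = ∑ z⁻ᵏ G[k]`. -/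
def kernel (G : TransferMatrix p q) (k : ℕ) : Matrix p q ℝ :=
  G.map (fun f => kernelScalar f (k : ℤ))

/-- The `H₂` norm `(∑ₖ ‖G[k]‖²)^(1/2)`, with the Frobenius norm of the kernels. -/
def h2norm [Fintype p] [Fintype q] (G : TransferMatrix p q) : ℝ≥0∞ :=
  (∑' k : ℕ, ENNReal.ofReal (∑ a, ∑ b, kernel G k a b ^ 2)) ^ (1 / 2 : ℝ)

end TransferMatrix

/-! ### The infinite-horizon state-feedback SLS problem -/

/-- A time-indexed sparsity pattern: `S k` is a binary matrix, used for `k ≥ 1`. -/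
abbrev SparsityPattern (p q : Type) : Type := ℕ → Matrix p q Bool

/-- The vector `v` is supported in `s`. -/
def SupportedIn {p : Type} (s : p → Bool) (v : p → ℝ) : Prop := ∀ a, s a = false → v a = 0

namespace SparsityPattern

/-- The pattern does not change from step `d` on. -/
def IsDelayed {p q : Type} (d : ℕ) (S : SparsityPattern p q) : Prop :=
  ∀ k, d ≤ k → S k = S d

/-- The column `i` of `S k`. -/
def column {p q : Type} (S : SparsityPattern p q) (i : q) (k : ℕ) : p → Bool := fun a => S k a i

/-- `Sp(𝔸ᵏ)` for `k ≤ d` and `Sp(𝔸ᵈ)` for `k ≥ d`, where `𝔸 = Sp(A)` is the `0`-`1` matrix of the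
support of `A`. -/
def ofDynamics {n : ℕ} (A : Matrix (Fin n) (Fin n) ℝ) (d : ℕ) :
    SparsityPattern (Fin n) (Fin n) := by
  classical
  exact fun k => ((Matrix.of fun a b => if A a b = 0 then (0 : ℕ) else 1) ^ min k d).map
    (fun c => decide (c ≠ 0))

theorem isDelayed_ofDynamics {n : ℕ} (A : Matrix (Fin n) (Fin n) ℝ) (d : ℕ) :
    (ofDynamics A d).IsDelayed d := by
  intro k hk
  simp [ofDynamics, min_eq_right hk]

end SparsityPattern

namespace SLS

open TransferMatrix

variable {n m : ℕ}

/-- The constraints of the state-feedback problem: achievability of the closed-loop maps and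
sparsity of their kernels. -/
structure IsFeasible (A : Matrix (Fin n) (Fin n) ℝ) (B : Matrix (Fin n) (Fin m) ℝ)
    (Sx : SparsityPattern (Fin n) (Fin n)) (Su : SparsityPattern (Fin m) (Fin n))
    (Φx : TransferMatrix (Fin n) (Fin n)) (Φu : TransferMatrix (Fin m) (Fin n)) : Prop where
  achievable : zSub A * Φx - const B * Φu = 1
  stable_x : IsInvZRHInf Φx
  stable_u : IsInvZRHInf Φu
  sparse_x : ∀ k, 1 ≤ k → ∀ i, SupportedIn (Sx.column i k) (fun a => kernel Φx k a i)
  sparse_u : ∀ k, 1 ≤ k → ∀ i, SupportedIn (Su.column i k) (fun a => kernel Φu k a i)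

/-- The objective `‖[Q^{1/2} Φx; R^{1/2} Φu]‖_{H₂}`. -/
def cost (Q : Matrix (Fin n) (Fin n) ℝ) (R : Matrix (Fin m) (Fin m) ℝ)
    (Φx : TransferMatrix (Fin n) (Fin n)) (Φu : TransferMatrix (Fin m) (Fin n)) : ℝ≥0∞ :=
  h2norm (Matrix.fromRows (const (CFC.sqrt Q) * Φx) (const (CFC.sqrt R) * Φu))

/-- `(Φx, Φu)` is a minimizer of the state-feedback problem. -/
def IsOptimal (A : Matrix (Fin n) (Fin n) ℝ) (B : Matrix (Fin n) (Fin m) ℝ)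
    (Q : Matrix (Fin n) (Fin n) ℝ) (R : Matrix (Fin m) (Fin m) ℝ)
    (Sx : SparsityPattern (Fin n) (Fin n)) (Su : SparsityPattern (Fin m) (Fin n))
    (Φx : TransferMatrix (Fin n) (Fin n)) (Φu : TransferMatrix (Fin m) (Fin n)) : Prop :=
  IsFeasible A B Sx Su Φx Φu ∧
    ∀ Ψx Ψu, IsFeasible A B Sx Su Ψx Ψu → cost Q R Φx Φu ≤ cost Q R Ψx Ψu

/-- From the state `ξ` at time `k` there is a trajectory of the column dynamics that obeys the
column patterns `sx`, `su` at all times and is square summable. -/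
def HasAdmissibleContinuation (A : Matrix (Fin n) (Fin n) ℝ) (B : Matrix (Fin n) (Fin m) ℝ)
    (sx : ℕ → Fin n → Bool) (su : ℕ → Fin m → Bool) (k : ℕ) (ξ : Fin n → ℝ) : Prop :=
  ∃ (x : ℕ → Fin n → ℝ) (u : ℕ → Fin m → ℝ), x 0 = ξ ∧
    (∀ t, x (t + 1) = A *ᵥ x t + B *ᵥ u t) ∧
    (∀ t, SupportedIn (sx (k + t)) (x t)) ∧ (∀ t, SupportedIn (su (k + t)) (u t)) ∧
    Summable (fun t => x t ⬝ᵥ x t) ∧ Summable (fun t => u t ⬝ᵥ u t)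

/-- The constraints are feasible: in every column `i` the initial state `e_i` is allowed at time
`1`, and every state allowed at a time `k ≥ 1` has an admissible continuation. -/
def ConstraintsFeasible (A : Matrix (Fin n) (Fin n) ℝ) (B : Matrix (Fin n) (Fin m) ℝ)
    (Sx : SparsityPattern (Fin n) (Fin n)) (Su : SparsityPattern (Fin m) (Fin n)) : Prop :=
  ∀ i, Sx 1 i i = true ∧ ∀ k, 1 ≤ k → ∀ ξ, SupportedIn (Sx.column i k) ξ →
    HasAdmissibleContinuation A B (Sx.column i) (Su.column i) k ξ

/-! ### Elimination of the sparsity constraints -/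

/-- The Moore-Penrose inverse `(FᵀF)⁺ Fᵀ`, where `(FᵀF)⁺` inverts the nonzero eigenvalues of the
symmetric matrix `FᵀF` and keeps its kernel (`0⁻¹ = 0` in `ℝ`). -/
def pinv {p q : Type} [Fintype p] [Fintype q] [DecidableEq q] (F : Matrix p q ℝ) : Matrix q p ℝ :=
  cfc (fun x : ℝ => x⁻¹) (Fᵀ * F) * Fᵀ

/-- The `0`-`1` matrix whose kernel is the set of vectors supported in `s`: the standard basis
vectors of the positions outside `s`, as rows. -/
def offSupport {p : Type} [DecidableEq p] (s : p → Bool) : Matrix {a // s a = false} p ℝ :=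
  (1 : Matrix p p ℝ).submatrix Subtype.val id

/-- The `0`-`1` matrix whose range is the set of vectors supported in `s`: the standard basis
vectors of the positions in `s`, as columns. -/
def onSupport {p : Type} [DecidableEq p] (s : p → Bool) : Matrix p {a // s a = true} ℝ :=
  (1 : Matrix p p ℝ).submatrix id Subtype.val

/-- A matrix `N` that maps `ℝʳ` bijectively onto the nullspace of `F`. -/
structure NullBasis {p q : Type} [Fintype q] (F : Matrix p q ℝ) where
  r : ℕ
  N : Matrix q (Fin r) ℝ
  injective : Function.Injective N.mulVec
  range_eq : Set.range N.mulVec = {v | F *ᵥ v = 0}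

theorem NullBasis.nonempty {p q : Type} [Fintype q] (F : Matrix p q ℝ) :
    Nonempty (NullBasis F) := by
  let K := LinearMap.ker F.mulVecLin
  let b := Module.finBasis ℝ K
  let N : Matrix q (Fin (Module.finrank ℝ K)) ℝ := Matrix.of fun a j => (b j : q → ℝ) a
  have hN : ∀ c, N *ᵥ c = ((b.equivFun.symm c : K) : q → ℝ) := by
    intro c
    ext a
    simp [N, Matrix.mulVec, dotProduct, Module.Basis.equivFun_symm_apply, Finset.sum_apply,
      mul_comm]
  refine ⟨⟨_, N, ?_, ?_⟩⟩
  · intro c c' h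
    simp only [hN] at h
    exact b.equivFun.symm.injective (Subtype.ext h)
  · ext v
    simp only [Set.mem_range, hN]
    constructor
    · rintro ⟨c, rfl⟩
      exact (b.equivFun.symm c).2
    · intro hv
      exact ⟨b.equivFun ⟨v, hv⟩, by simp⟩

/-- Data of a linear-quadratic regulator problem with dynamics `x⁺ = A x + B r` and stage cost
`xᵀ Q x + 2 rᵀ Z x + rᵀ R r`. -/
structure LQData (σ ρ : Type) where
  A : Matrix σ σ ℝ
  B : Matrix σ ρ ℝ
  Q : Matrix σ σ ℝ
  Z : Matrix ρ σ ℝ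
  R : Matrix ρ ρ ℝ

namespace LQData

variable {σ ρ : Type} [Fintype σ] [Fintype ρ] [DecidableEq ρ]

/-- The gain `K = (R + BᵀXB)⁻¹ (BᵀXA + Z)`; the minimizing input is `r = -K x`. -/
def gain (D : LQData σ ρ) (X : Matrix σ σ ℝ) : Matrix ρ σ ℝ :=
  (D.R + D.Bᵀ * X * D.B)⁻¹ * (D.Bᵀ * X * D.A + D.Z)

/-- One backward step of the Riccati recursion. -/
def riccati (D : LQData σ ρ) (X : Matrix σ σ ℝ) : Matrix σ σ ℝ :=
  D.Q + D.Aᵀ * X * D.A -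
    (D.Aᵀ * X * D.B + D.Zᵀ) * (D.R + D.Bᵀ * X * D.B)⁻¹ * (D.Bᵀ * X * D.A + D.Z)

/-- The closed-loop matrix `A - B K`. -/
def closedLoop (D : LQData σ ρ) (X : Matrix σ σ ℝ) : Matrix σ σ ℝ :=
  D.A - D.B * D.gain X

/-- The problem in the coordinates `x = E ξ`, for `E` with orthonormal columns whose range is
invariant. -/
def restrict {τ : Type} (D : LQData σ ρ) (E : Matrix σ τ ℝ) : LQData τ ρ where
  A := Eᵀ * D.A * E
  B := Eᵀ * D.B
  Q := Eᵀ * D.Q * E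
  Z := D.Z * E
  R := D.R

end LQData

/-- `F = M_x⁺ B M_u`, where `su` is the input pattern at the current step and `sx` the state
pattern at the next step. -/
def elimF (B : Matrix (Fin n) (Fin m) ℝ) (su : Fin m → Bool) (sx : Fin n → Bool) :
    Matrix {a // sx a = false} {b // su b = true} ℝ :=
  offSupport sx * B * onSupport su

/-- `κ = M_u F† M_x⁺ A`. -/
def kappa (A : Matrix (Fin n) (Fin n) ℝ) (B : Matrix (Fin n) (Fin m) ℝ)
    (su : Fin m → Bool) (sx : Fin n → Bool) : Matrix (Fin m) (Fin n) ℝ :=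
  onSupport su * pinv (elimF B su sx) * offSupport sx * A

/-- The regulator problem in the free variable `r`, after the substitution
`φ_u = -κ φ_x + M_u N r`. -/
def reducedData (A : Matrix (Fin n) (Fin n) ℝ) (B : Matrix (Fin n) (Fin m) ℝ)
    (Q : Matrix (Fin n) (Fin n) ℝ) (R : Matrix (Fin m) (Fin m) ℝ)
    (su : Fin m → Bool) (sx : Fin n → Bool) (N : NullBasis (elimF B su sx)) :
    LQData (Fin n) (Fin N.r) where
  A := A - B * kappa A B su sx
  B := B * (onSupport su * N.N)
  Q := Q + (kappa A B su sx)ᵀ * R * kappa A B su sx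
  Z := -((onSupport su * N.N)ᵀ * R * kappa A B su sx)
  R := (onSupport su * N.N)ᵀ * R * (onSupport su * N.N)

/-- The static problem in the coordinates of the states supported in `sx`. -/
def staticData (A : Matrix (Fin n) (Fin n) ℝ) (B : Matrix (Fin n) (Fin m) ℝ)
    (Q : Matrix (Fin n) (Fin n) ℝ) (R : Matrix (Fin m) (Fin m) ℝ)
    (su : Fin m → Bool) (sx : Fin n → Bool) (N : NullBasis (elimF B su sx)) :
    LQData {a // sx a = true} (Fin N.r) :=
  (reducedData A B Q R su sx N).restrict (onSupport sx)

/-- A positive definite solution `X = Ric(X)` of the stationary Riccati equation of the static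
problem. -/
def IsStationarySolution (A : Matrix (Fin n) (Fin n) ℝ) (B : Matrix (Fin n) (Fin m) ℝ)
    (Q : Matrix (Fin n) (Fin n) ℝ) (R : Matrix (Fin m) (Fin m) ℝ)
    (su : Fin m → Bool) (sx : Fin n → Bool) (N : NullBasis (elimF B su sx))
    (X : Matrix {a // sx a = true} {a // sx a = true} ℝ) : Prop :=
  X.PosDef ∧ (staticData A B Q R su sx N).riccati X = X

/-! ### The optimal closed-loop maps of one column -/

section Column

variable (A : Matrix (Fin n) (Fin n) ℝ) (B : Matrix (Fin n) (Fin m) ℝ)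
  (Q : Matrix (Fin n) (Fin n) ℝ) (R : Matrix (Fin m) (Fin m) ℝ)
  (sx : ℕ → Fin n → Bool) (su : ℕ → Fin m → Bool) (d : ℕ)
  (N : ∀ k, NullBasis (elimF B (su k) (sx (k + 1))))
  (Nstar : NullBasis (elimF B (su d) (sx d)))
  (Xstar : Matrix {a // sx d a = true} {a // sx d a = true} ℝ)

/-- The matrix that takes over at step `d + 1`: the stationary solution, as a quadratic form on
the vectors supported in `sx d`, extended by zero. -/
def terminalX : Matrix (Fin n) (Fin n) ℝ :=
  onSupport (sx d) * Xstar * (onSupport (sx d))ᵀ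

/-- The backward recursion, counted from the end: after `j` steps it gives `X[d + 1 - j]`. -/
def backwardX : ℕ → Matrix (Fin n) (Fin n) ℝ
  | 0 => terminalX sx d Xstar
  | j + 1 => (reducedData A B Q R (su (d - j)) (sx (d - j + 1)) (N (d - j))).riccati
      (backwardX j)

/-- `X[k]` for `1 ≤ k ≤ d + 1`: `X[d + 1]` is the stationary solution and
`X[k] = Ric_k(X[k + 1])`. -/
def Xtil (k : ℕ) : Matrix (Fin n) (Fin n) ℝ :=
  backwardX A B Q R sx su d N Xstar (d + 1 - k)

/-- The gain `K[k]` in the free variable. -/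
def Ktil (k : ℕ) : Matrix (Fin (N k).r) (Fin n) ℝ :=
  (reducedData A B Q R (su k) (sx (k + 1)) (N k)).gain (Xtil A B Q R sx su d N Xstar (k + 1))

/-- The closed-loop matrix at step `k`. -/
def Acl (k : ℕ) : Matrix (Fin n) (Fin n) ℝ :=
  (reducedData A B Q R (su k) (sx (k + 1)) (N k)).closedLoop
    (Xtil A B Q R sx su d N Xstar (k + 1))

/-- The gain at step `k` in the original input, `φ_u[k] = -(κ[k] + M_u[k] N[k] K[k]) φ_x[k]`. -/
def Kcl (k : ℕ) : Matrix (Fin m) (Fin n) ℝ :=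
  -(kappa A B (su k) (sx (k + 1)) +
    onSupport (su k) * (N k).N * Ktil A B Q R sx su d N Xstar k)

/-- The stationary closed-loop matrix, extended by zero outside `sx d`. -/
def AclStar : Matrix (Fin n) (Fin n) ℝ :=
  onSupport (sx d) * (staticData A B Q R (su d) (sx d) Nstar).closedLoop Xstar *
    (onSupport (sx d))ᵀ

/-- The stationary gain in the original input, extended by zero outside `sx d`. -/
def KclStar : Matrix (Fin m) (Fin n) ℝ :=
  -(kappa A B (su d) (sx d) * onSupport (sx d) +
      onSupport (su d) * Nstar.N * (staticData A B Q R (su d) (sx d) Nstar).gain Xstar) *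
    (onSupport (sx d))ᵀ

/-- The block matrix `A_SF`: block `(p, q)` (counted from `0`) is the closed-loop matrix of step
`q + 1` if `p = q + 1`, the stationary closed-loop matrix if `p = q = d`, and `0` otherwise. -/
def ASF : Matrix (Fin (d + 1) × Fin n) (Fin (d + 1) × Fin n) ℝ :=
  Matrix.of fun a b =>
    if (a.1 : ℕ) = (b.1 : ℕ) + 1 then Acl A B Q R sx su d N Xstar ((b.1 : ℕ) + 1) a.2 b.2
    else if (a.1 : ℕ) = d ∧ (b.1 : ℕ) = d then AclStar A B Q R sx su d Nstar Xstar a.2 b.2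
    else 0

/-- The block column `B_SF = [e_i; 0; …; 0]`. -/
def BSF (n d : ℕ) (i : Fin n) : Matrix (Fin (d + 1) × Fin n) Unit ℝ :=
  Matrix.of fun a _ => if a.1 = 0 ∧ a.2 = i then 1 else 0

/-- The block row `C_SF = [I I ⋯ I]`. -/
def CSF (n d : ℕ) : Matrix (Fin n) (Fin (d + 1) × Fin n) ℝ :=
  Matrix.of fun a b => (1 : Matrix (Fin n) (Fin n) ℝ) a b.2

/-- The block row `K_SF` of the gains of the steps `1, …, d`, followed by the stationary gain. -/
def KSF : Matrix (Fin m) (Fin (d + 1) × Fin n) ℝ :=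
  Matrix.of fun a b =>
    if (b.1 : ℕ) < d then Kcl A B Q R sx su d N Xstar ((b.1 : ℕ) + 1) a b.2
    else KclStar A B Q R sx su d Nstar Xstar a b.2

end Column

end SLS

end

/-!
Since `Φx` and `Φu` are strictly proper, the achievability constraint says that the columns of their
kernels are trajectories of `x⁺ = A x + B u` that start at the standard basis vectors
(`SLS.isFeasible_iff`), and the squared objective is the sum of the quadratic costs of these
trajectories (`SLS.cost_eq_sum_columnCost`). So the problem splits into one infinite-horizon
regulator problem per column, with supports of states and inputs prescribed at each time.

The inputs that keep the next state in its pattern are exactly `-κ x + M_u N r` with a free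
parameter `r` (`SLS.exists_free_input`, `SLS.supportedIn_next`), because `F F† F = F`. In the
variable `r` a step is an unconstrained regulator step, and completion of squares
(`SLS.LQData.stage_add_quadForm`) shows that the Riccati map and the gain solve its Bellman equation
with a unique minimizer (`SLS.bellmanStep_reducedData`). Restricted to the states in the pattern,
the static data have the same Riccati map and gain (`SLS.LQData.riccati_restrict`,
`SLS.LQData.gain_restrict`), so a stationary solution continues the backward recursion to all times
(`SLS.isBellman_column`).

Summing the Bellman identity along a trajectory of finite cost, whose states tend to zero as `Q` is
positive definite, bounds the cost from below by the value of the initial state, with equality only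
for the trajectory of the optimal feedback (`SLS.IsBellman.quadForm_le_tsum`,
`SLS.IsBellman.eq_feedback`). Two stationary solutions bound each other, as the closed loop of
one is a competitor for the other; existence follows by value iteration from `0`, which is monotone
and bounded by the cost of an admissible continuation (`SLS.exists_isStationarySolution`).

The realization reproduces the optimal trajectories: its state at time `t + 1` occupies only the
block `min t d` (`SLS.ASF_pow_mul_BSF`). It is stable: a nonzero eigenvalue of `A_SF` belongs to the
stationary closed loop, for which the stationary solution is a Lyapunov function
(`SLS.norm_lt_one_of_charpoly_ASF`). Finally, a rational function is determined by its expansion at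
infinity, a ring homomorphism into Laurent series in `1/z` (`TransferMatrix.expansion`), so the
equality of kernels is the equality of transfer matrices (`SLS.isOptimal_iff_eq`).
-/

namespace SLS

/-! ### Quadratic forms and completion of squares -/

section Quadratic

variable {p q : Type} [Fintype p] [Fintype q]

/-- The quadratic form `xᵀ M x`. -/
def quadForm (M : Matrix p p ℝ) (x : p → ℝ) : ℝ := x ⬝ᵥ M *ᵥ x

theorem dotProduct_transpose_mulVec (M : Matrix p q ℝ) (a : q → ℝ) (b : p → ℝ) :
    a ⬝ᵥ Mᵀ *ᵥ b = (M *ᵥ a) ⬝ᵥ b := by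
  rw [mulVec_transpose, dotProduct_comm, ← dotProduct_mulVec, dotProduct_comm]

theorem dotProduct_mulVec_comm_of_symm {M : Matrix p p ℝ} (hM : Mᵀ = M) (a b : p → ℝ) :
    a ⬝ᵥ M *ᵥ b = b ⬝ᵥ M *ᵥ a := by
  conv_lhs => rw [← hM, dotProduct_transpose_mulVec, dotProduct_comm]

theorem quadForm_add {M : Matrix p p ℝ} (hM : Mᵀ = M) (a b : p → ℝ) :
    quadForm M (a + b) = quadForm M a + 2 * (a ⬝ᵥ M *ᵥ b) + quadForm M b := by
  simp only [quadForm, mulVec_add, add_dotProduct, dotProduct_add]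
  rw [dotProduct_mulVec_comm_of_symm hM b a]
  ring

theorem quadForm_nonneg {M : Matrix p p ℝ} (hM : M.PosSemidef) (x : p → ℝ) :
    0 ≤ quadForm M x := by
  simpa [quadForm] using hM.dotProduct_mulVec_nonneg x

theorem quadForm_pos {M : Matrix p p ℝ} (hM : M.PosDef) {x : p → ℝ} (hx : x ≠ 0) :
    0 < quadForm M x := by
  simpa [quadForm] using hM.dotProduct_mulVec_pos hx

theorem eq_zero_of_quadForm_eq_zero {M : Matrix p p ℝ} (hM : M.PosDef) {x : p → ℝ}
    (h : quadForm M x = 0) : x = 0 := by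
  by_contra hx
  exact (quadForm_pos hM hx).ne' h

omit [Fintype p] in
theorem _root_.Matrix.PosSemidef.transpose_eq {M : Matrix p p ℝ} (hM : M.PosSemidef) :
    Mᵀ = M := by
  simpa [conjTranspose_eq_transpose_of_trivial] using hM.isHermitian.eq

theorem posSemidef_of_quadForm_nonneg {M : Matrix p p ℝ} (hM : Mᵀ = M)
    (h : ∀ x, 0 ≤ quadForm M x) : M.PosSemidef :=
  .of_dotProduct_mulVec_nonneg (by
    simpa [IsHermitian, conjTranspose_eq_transpose_of_trivial] using hM)
    (by simpa [quadForm] using h)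

theorem posDef_of_quadForm_pos {M : Matrix p p ℝ} (hM : Mᵀ = M)
    (h : ∀ x, x ≠ 0 → 0 < quadForm M x) : M.PosDef :=
  .of_dotProduct_mulVec_pos (by
    simpa [IsHermitian, conjTranspose_eq_transpose_of_trivial] using hM)
    (by simpa [quadForm] using h)

theorem quadForm_conj (M : Matrix p p ℝ) (E : Matrix p q ℝ) (x : q → ℝ) :
    quadForm (Eᵀ * M * E) x = quadForm M (E *ᵥ x) := by
  simp only [quadForm, ← mulVec_mulVec, dotProduct_transpose_mulVec]

theorem quadForm_conj' (M : Matrix q q ℝ) (E : Matrix p q ℝ) (x : p → ℝ) :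
    quadForm (E * M * Eᵀ) x = quadForm M (Eᵀ *ᵥ x) := by
  simpa using quadForm_conj M Eᵀ x

theorem _root_.Matrix.PosSemidef.conj_transpose {M : Matrix p p ℝ} (hM : M.PosSemidef)
    (E : Matrix p q ℝ) : (Eᵀ * M * E).PosSemidef := by
  simpa [conjTranspose_eq_transpose_of_trivial] using hM.conjTranspose_mul_mul_same E

theorem _root_.Matrix.PosSemidef.conj_transpose' {M : Matrix q q ℝ} (hM : M.PosSemidef)
    (E : Matrix p q ℝ) : (E * M * Eᵀ).PosSemidef := by
  simpa using hM.conj_transpose Eᵀ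

theorem dotProduct_mulVec_eq_quadForm {M : Matrix p p ℝ} (hM : Mᵀ = M) (a b : p → ℝ) :
    a ⬝ᵥ M *ᵥ b = (quadForm M (a + b) - quadForm M a - quadForm M b) / 2 := by
  rw [quadForm_add hM]; ring

/-- A symmetric matrix is determined by its quadratic form. -/
theorem eq_of_quadForm_eq {M M' : Matrix p p ℝ} (hM : Mᵀ = M) (hM' : M'ᵀ = M')
    (h : ∀ x, quadForm M x = quadForm M' x) : M = M' := by
  classical
  ext i j
  have := dotProduct_mulVec_eq_quadForm hM (Pi.single i 1) (Pi.single j 1)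
  rw [h, h, h, ← dotProduct_mulVec_eq_quadForm hM'] at this
  simpa using this

theorem sum_sq_sqrt_mulVec [DecidableEq p] {M : Matrix p p ℝ}
    (hM : M.PosSemidef) (v : p → ℝ) : ∑ a, (CFC.sqrt M *ᵥ v) a ^ 2 = quadForm M v := by
  have h1 : (CFC.sqrt M)ᵀ = CFC.sqrt M :=
    (Matrix.nonneg_iff_posSemidef.1 (CFC.sqrt_nonneg M)).transpose_eq
  have h2 := quadForm_conj (1 : Matrix p p ℝ) (CFC.sqrt M) v
  rw [Matrix.mul_one, h1, CFC.sqrt_mul_sqrt_self M (Matrix.nonneg_iff_posSemidef.2 hM)] at h2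
  rw [h2, quadForm, one_mulVec, dotProduct]
  simp [sq]

end Quadratic

namespace LQData

variable {σ ρ : Type} [Fintype σ] [Fintype ρ] [DecidableEq ρ]

/-- The stage cost `xᵀ Q x + 2 rᵀ Z x + rᵀ R r`. -/
def stage (D : LQData σ ρ) (x : σ → ℝ) (r : ρ → ℝ) : ℝ :=
  quadForm D.Q x + 2 * (r ⬝ᵥ D.Z *ᵥ x) + quadForm D.R r

omit [DecidableEq ρ] in
/-- The Hessian `R + Bᵀ X B` of the Bellman step in the input is positive definite. -/
theorem posDef_hessian {D : LQData σ ρ} (hR : D.R.PosDef) {X : Matrix σ σ ℝ}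
    (hX : X.PosSemidef) : (D.R + D.Bᵀ * X * D.B).PosDef :=
  hR.add_posSemidef (hX.conj_transpose D.B)

/-- Completion of squares in one Bellman step. -/
theorem stage_add_quadForm (D : LQData σ ρ) (hR : D.R.PosDef) {X : Matrix σ σ ℝ}
    (hX : X.PosSemidef) (x : σ → ℝ) (r : ρ → ℝ) :
    D.stage x r + quadForm X (D.A *ᵥ x + D.B *ᵥ r) =
      quadForm (D.riccati X) x +
        quadForm (D.R + D.Bᵀ * X * D.B) (r + D.gain X *ᵥ x) := by
  have hW := posDef_hessian hR hX
  have hdet : IsUnit (D.R + D.Bᵀ * X * D.B).det := (isUnit_iff_isUnit_det _).1 hW.isUnit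
  have hWs := hW.posSemidef.transpose_eq
  have hXs := hX.transpose_eq
  have hgain : (D.R + D.Bᵀ * X * D.B) *ᵥ (D.gain X *ᵥ x) = (D.Bᵀ * X * D.A + D.Z) *ᵥ x := by
    rw [gain, mulVec_mulVec, mul_nonsing_inv_cancel_left _ _ hdet]
  -- The value lost by the Riccati map against `Q + AᵀXA` is the square of the gain.
  have hric : quadForm (D.riccati X) x = quadForm D.Q x + quadForm X (D.A *ᵥ x) -
      (D.gain X *ᵥ x) ⬝ᵥ ((D.Bᵀ * X * D.A + D.Z) *ᵥ x) := by
    have hS : D.Aᵀ * X * D.B + D.Zᵀ = (D.Bᵀ * X * D.A + D.Z)ᵀ := by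
      simp [transpose_mul, hXs, Matrix.mul_assoc]
    have h1 : (D.Bᵀ * X * D.A + D.Z)ᵀ * (D.R + D.Bᵀ * X * D.B)⁻¹ * (D.Bᵀ * X * D.A + D.Z) =
        (D.Bᵀ * X * D.A + D.Z)ᵀ * D.gain X := by
      rw [gain, Matrix.mul_assoc]
    rw [riccati, hS, h1]
    simp only [quadForm, sub_mulVec, add_mulVec D.Q, dotProduct_sub, dotProduct_add]
    rw [← mulVec_mulVec x (D.Bᵀ * X * D.A + D.Z)ᵀ, dotProduct_transpose_mulVec,
      dotProduct_comm _ (D.gain X *ᵥ x)]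
    simp only [← mulVec_mulVec, dotProduct_transpose_mulVec]
  rw [quadForm_add hWs, hgain, hric, quadForm_add hXs]
  have hlast : quadForm (D.R + D.Bᵀ * X * D.B) (D.gain X *ᵥ x) =
      (D.gain X *ᵥ x) ⬝ᵥ ((D.Bᵀ * X * D.A + D.Z) *ᵥ x) := by
    rw [quadForm, hgain]
  have hr : quadForm (D.R + D.Bᵀ * X * D.B) r = quadForm D.R r + quadForm X (D.B *ᵥ r) := by
    rw [← quadForm_conj]
    simp [quadForm, add_mulVec]
  have hc : r ⬝ᵥ ((D.Bᵀ * X * D.A + D.Z) *ᵥ x) =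
      (D.A *ᵥ x) ⬝ᵥ X *ᵥ (D.B *ᵥ r) + r ⬝ᵥ D.Z *ᵥ x := by
    rw [dotProduct_mulVec_comm_of_symm hXs]
    simp only [add_mulVec, dotProduct_add, ← mulVec_mulVec, dotProduct_transpose_mulVec]
  rw [hlast, hr, hc, stage]
  ring

theorem transpose_riccati {D : LQData σ ρ} (hQ : D.Qᵀ = D.Q) (hR : D.R.PosDef)
    {X : Matrix σ σ ℝ} (hX : X.PosSemidef) : (D.riccati X)ᵀ = D.riccati X := by
  have hRs := hR.posSemidef.transpose_eq
  have hXs := hX.transpose_eq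
  simp only [riccati, transpose_sub, transpose_add D.Q, hQ, transpose_mul, transpose_nonsing_inv,
    hRs, transpose_add, transpose_transpose, hXs, Matrix.mul_assoc]

theorem riccati_restrict {τ : Type} [Fintype τ] (D : LQData σ ρ) (E : Matrix σ τ ℝ)
    (X : Matrix τ τ ℝ) :
    (D.restrict E).riccati X = Eᵀ * D.riccati (E * X * Eᵀ) * E := by
  simp only [riccati, restrict, transpose_mul, transpose_transpose, Matrix.mul_assoc,
    Matrix.mul_sub, Matrix.sub_mul, Matrix.mul_add, Matrix.add_mul]

theorem gain_restrict {τ : Type} [Fintype τ] (D : LQData σ ρ) (E : Matrix σ τ ℝ)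
    (X : Matrix τ τ ℝ) :
    (D.restrict E).gain X = D.gain (E * X * Eᵀ) * E := by
  simp only [gain, restrict, transpose_mul, transpose_transpose, Matrix.mul_assoc,
    Matrix.mul_add, Matrix.add_mul]

theorem closedLoop_restrict {τ : Type} [Fintype τ] (D : LQData σ ρ) (E : Matrix σ τ ℝ)
    (X : Matrix τ τ ℝ) :
    (D.restrict E).closedLoop X = Eᵀ * D.closedLoop (E * X * Eᵀ) * E := by
  rw [closedLoop, gain_restrict]
  simp only [closedLoop, restrict, Matrix.mul_assoc, Matrix.mul_sub, Matrix.sub_mul]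

end LQData

/-! ### Elimination of the sparsity constraints -/

section Elimination

variable {p q : Type} [Fintype p] [Fintype q] [DecidableEq q]

/-- The Moore-Penrose identity `F F† F = F`: it suffices to check it after multiplication by `Fᵀ`,
where it says `x x⁻¹ x = x` on the spectrum of `FᵀF`. -/
theorem mul_pinv_mul (F : Matrix p q ℝ) : F * (pinv F * F) = F := by
  have hsa : IsSelfAdjoint (Fᵀ * F) := by
    have h := (isHermitian_conjTranspose_mul_self F).isSelfAdjoint
    rwa [conjTranspose_eq_transpose_of_trivial] at h
  have hc : ∀ f : ℝ → ℝ, ContinuousOn f (spectrum ℝ (Fᵀ * F)) := fun f =>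
    (Matrix.finite_real_spectrum (A := Fᵀ * F)).continuousOn f
  have key : Fᵀ * F * cfc (fun x : ℝ => x⁻¹) (Fᵀ * F) * (Fᵀ * F) = Fᵀ * F := by
    have h1 : Fᵀ * F = cfc (fun x : ℝ => x) (Fᵀ * F) := (cfc_id' ℝ (Fᵀ * F)).symm
    calc Fᵀ * F * cfc (fun x : ℝ => x⁻¹) (Fᵀ * F) * (Fᵀ * F)
        = cfc (fun x : ℝ => x) (Fᵀ * F) * cfc (fun x : ℝ => x⁻¹) (Fᵀ * F) *
            cfc (fun x : ℝ => x) (Fᵀ * F) := by rw [← h1]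
      _ = cfc (fun x : ℝ => x * x⁻¹ * x) (Fᵀ * F) := by
          rw [← cfc_mul _ _ _ (hc _) (hc _), ← cfc_mul _ _ _ (hc _) (hc _)]
      _ = cfc (fun x : ℝ => x) (Fᵀ * F) := by
          congr 1
          funext x
          exact mul_inv_mul_cancel x
      _ = Fᵀ * F := h1.symm
  have hz : Fᴴ * F * (pinv F * F - 1) = 0 := by
    rw [conjTranspose_eq_transpose_of_trivial, Matrix.mul_sub, Matrix.mul_one, pinv, sub_eq_zero]
    rw [← Matrix.mul_assoc, ← Matrix.mul_assoc, Matrix.mul_assoc _ Fᵀ F, key]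
  rw [conjTranspose_mul_self_mul_eq_zero, Matrix.mul_sub, Matrix.mul_one, sub_eq_zero] at hz
  exact hz

end Elimination

section Support

variable {p : Type} [Fintype p] [DecidableEq p]

theorem offSupport_mulVec (s : p → Bool) (v : p → ℝ) (a : {a // s a = false}) :
    (offSupport s *ᵥ v) a = v a := by
  simp [offSupport, mulVec, dotProduct, Matrix.one_apply]

theorem supportedIn_iff_offSupport (s : p → Bool) (v : p → ℝ) :
    SupportedIn s v ↔ offSupport s *ᵥ v = 0 := by
  constructor
  · intro h
    ext a
    rw [offSupport_mulVec]
    exact h a a.2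
  · intro h a ha
    rw [← offSupport_mulVec s v ⟨a, ha⟩, h]
    rfl

theorem transpose_onSupport_mulVec (s : p → Bool) (v : p → ℝ) (a : {a // s a = true}) :
    ((onSupport s)ᵀ *ᵥ v) a = v a := by
  simp [onSupport, mulVec, dotProduct, Matrix.one_apply]

theorem transpose_onSupport_mul_onSupport (s : p → Bool) :
    (onSupport s)ᵀ * onSupport s = 1 := by
  ext a b
  rw [Matrix.mul_apply]
  simp [onSupport, Matrix.one_apply, Subtype.ext_iff, eq_comm]

theorem onSupport_mulVec_injective (s : p → Bool) :
    Function.Injective (onSupport s).mulVec := by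
  intro v w h
  have := congrArg ((onSupport s)ᵀ.mulVec) h
  simpa [mulVec_mulVec, transpose_onSupport_mul_onSupport] using this

theorem supportedIn_onSupport_mulVec (s : p → Bool) (v : {a // s a = true} → ℝ) :
    SupportedIn s (onSupport s *ᵥ v) := by
  intro a ha
  refine Finset.sum_eq_zero fun b _ => ?_
  change (1 : Matrix p p ℝ) a b * v b = 0
  have : a ≠ b := by
    rintro rfl
    simp [b.2] at ha
  rw [Matrix.one_apply_ne this, zero_mul]

theorem onSupport_mulVec_transpose_mulVec {s : p → Bool} {v : p → ℝ} (hv : SupportedIn s v) :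
    onSupport s *ᵥ ((onSupport s)ᵀ *ᵥ v) = v := by
  ext a
  cases ha : s a
  · rw [hv a ha, supportedIn_onSupport_mulVec s _ a ha]
  · have h := transpose_onSupport_mulVec s (onSupport s *ᵥ ((onSupport s)ᵀ *ᵥ v)) ⟨a, ha⟩
    rw [mulVec_mulVec, transpose_onSupport_mul_onSupport, one_mulVec,
      transpose_onSupport_mulVec] at h
    exact h.symm

end Support

section Reduced

variable {n m : ℕ} {A : Matrix (Fin n) (Fin n) ℝ} {B : Matrix (Fin n) (Fin m) ℝ}
  {Q : Matrix (Fin n) (Fin n) ℝ} {R : Matrix (Fin m) (Fin m) ℝ}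
  {su : Fin m → Bool} {sx : Fin n → Bool}

theorem elimF_mulVec (v : {b // su b = true} → ℝ) :
    elimF B su sx *ᵥ v = offSupport sx *ᵥ (B *ᵥ (onSupport su *ᵥ v)) := by
  simp [elimF, Matrix.mul_assoc]

/-- If some admissible input keeps the next state in its pattern, the particular input `-κ x`
does so too. -/
theorem elimF_mulVec_pinv {x : Fin n → ℝ} {u : Fin m → ℝ} (hu : SupportedIn su u)
    (hnext : SupportedIn sx (A *ᵥ x + B *ᵥ u)) :
    elimF B su sx *ᵥ (pinv (elimF B su sx) *ᵥ (offSupport sx *ᵥ (A *ᵥ x))) =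
      offSupport sx *ᵥ (A *ᵥ x) := by
  rw [supportedIn_iff_offSupport, mulVec_add, ← onSupport_mulVec_transpose_mulVec hu,
    ← elimF_mulVec] at hnext
  rw [eq_neg_of_add_eq_zero_left hnext]
  simp only [mulVec_neg]
  rw [mulVec_mulVec _ (pinv _), mulVec_mulVec, mul_pinv_mul]

theorem kappa_mulVec (x : Fin n → ℝ) : kappa A B su sx *ᵥ x =
    onSupport su *ᵥ (pinv (elimF B su sx) *ᵥ (offSupport sx *ᵥ (A *ᵥ x))) := by
  simp [kappa, Matrix.mul_assoc]

theorem NullBasis.mulVec_mulVec_eq_zero {p q : Type} [Fintype q] {F : Matrix p q ℝ}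
    (N : NullBasis F) (r : Fin N.r → ℝ) : F *ᵥ (N.N *ᵥ r) = 0 := by
  have : N.N *ᵥ r ∈ Set.range N.N.mulVec := ⟨r, rfl⟩
  rw [N.range_eq] at this
  exact this

variable (N : NullBasis (elimF B su sx))

/-- The admissible inputs at a state that can be continued are exactly `-κ x + U r`. -/
theorem exists_free_input {x : Fin n → ℝ} {u : Fin m → ℝ} (hu : SupportedIn su u)
    (hnext : SupportedIn sx (A *ᵥ x + B *ᵥ u)) :
    ∃ r, u = -(kappa A B su sx *ᵥ x) + (onSupport su * N.N) *ᵥ r := by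
  have h := elimF_mulVec_pinv hu hnext
  rw [supportedIn_iff_offSupport, mulVec_add, ← onSupport_mulVec_transpose_mulVec hu,
    ← elimF_mulVec, ← h, ← mulVec_add] at hnext
  have hmem : pinv (elimF B su sx) *ᵥ (offSupport sx *ᵥ (A *ᵥ x)) + (onSupport su)ᵀ *ᵥ u ∈
      Set.range N.N.mulVec := by
    rw [N.range_eq]
    exact hnext
  obtain ⟨r, hr⟩ := hmem
  refine ⟨r, ?_⟩
  rw [← mulVec_mulVec, hr, kappa_mulVec, mulVec_add, onSupport_mulVec_transpose_mulVec hu,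
    neg_add_cancel_left]

theorem supportedIn_free_input (x : Fin n → ℝ) (r : Fin N.r → ℝ) :
    SupportedIn su (-(kappa A B su sx *ᵥ x) + (onSupport su * N.N) *ᵥ r) := by
  intro a ha
  rw [kappa_mulVec, ← mulVec_mulVec, Pi.add_apply, Pi.neg_apply,
    supportedIn_onSupport_mulVec _ _ a ha, supportedIn_onSupport_mulVec _ _ a ha]
  simp

theorem supportedIn_next {x : Fin n → ℝ} {u : Fin m → ℝ} (hu : SupportedIn su u)
    (hnext : SupportedIn sx (A *ᵥ x + B *ᵥ u)) (r : Fin N.r → ℝ) :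
    SupportedIn sx
      (A *ᵥ x + B *ᵥ (-(kappa A B su sx *ᵥ x) + (onSupport su * N.N) *ᵥ r)) := by
  rw [supportedIn_iff_offSupport, ← mulVec_mulVec, kappa_mulVec, mulVec_add B, mulVec_neg,
    mulVec_add, mulVec_add, mulVec_neg, ← elimF_mulVec, ← elimF_mulVec,
    elimF_mulVec_pinv hu hnext, N.mulVec_mulVec_eq_zero]
  simp

theorem onSupport_mul_nullBasis_injective :
    Function.Injective (onSupport su * N.N).mulVec := by
  intro r r' h
  simp only [← mulVec_mulVec] at h
  exact N.injective (onSupport_mulVec_injective su h)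

theorem reducedData_dynamics (x : Fin n → ℝ) (r : Fin N.r → ℝ) :
    (reducedData A B Q R su sx N).A *ᵥ x + (reducedData A B Q R su sx N).B *ᵥ r =
      A *ᵥ x + B *ᵥ (-(kappa A B su sx *ᵥ x) + (onSupport su * N.N) *ᵥ r) := by
  simp only [reducedData, sub_mulVec, mulVec_add, mulVec_neg, mulVec_mulVec]
  abel

theorem reducedData_stage (hR : R.PosDef) (x : Fin n → ℝ) (r : Fin N.r → ℝ) :
    (reducedData A B Q R su sx N).stage x r = quadForm Q x +
      quadForm R (-(kappa A B su sx *ᵥ x) + (onSupport su * N.N) *ᵥ r) := by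
  have hRs := hR.posSemidef.transpose_eq
  rw [quadForm_add hRs, dotProduct_mulVec_comm_of_symm hRs]
  simp only [LQData.stage, reducedData]
  rw [quadForm_conj, neg_mulVec, dotProduct_neg]
  have h1 : quadForm (Q + (kappa A B su sx)ᵀ * R * kappa A B su sx) x =
      quadForm Q x + quadForm R (kappa A B su sx *ᵥ x) := by
    rw [← quadForm_conj]
    simp [quadForm, add_mulVec]
  have h2 : quadForm R (-(kappa A B su sx *ᵥ x)) = quadForm R (kappa A B su sx *ᵥ x) := by
    simp [quadForm, mulVec_neg]
  have h3 : r ⬝ᵥ ((onSupport su * N.N)ᵀ * R * kappa A B su sx) *ᵥ x =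
      ((onSupport su * N.N) *ᵥ r) ⬝ᵥ R *ᵥ (kappa A B su sx *ᵥ x) := by
    rw [Matrix.mul_assoc, ← mulVec_mulVec, dotProduct_transpose_mulVec, mulVec_mulVec]
  rw [h1, h2, h3, mulVec_neg, dotProduct_neg]
  ring

theorem posDef_reducedData_R (hR : R.PosDef) : (reducedData A B Q R su sx N).R.PosDef := by
  have h := hR.conjTranspose_mul_mul_same (onSupport_mul_nullBasis_injective N)
  rwa [conjTranspose_eq_transpose_of_trivial] at h

theorem transpose_reducedData_Q (hQ : Q.PosDef) (hR : R.PosDef) :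
    (reducedData A B Q R su sx N).Qᵀ = (reducedData A B Q R su sx N).Q := by
  simp [reducedData, transpose_mul, hQ.posSemidef.transpose_eq, hR.posSemidef.transpose_eq,
    Matrix.mul_assoc]

/-- The Riccati map of the reduced data dominates the state cost `Q`. -/
theorem quadForm_le_quadForm_riccati (hR : R.PosDef) {X : Matrix (Fin n) (Fin n) ℝ}
    (hX : X.PosSemidef) (x : Fin n → ℝ) :
    quadForm Q x ≤ quadForm ((reducedData A B Q R su sx N).riccati X) x := by
  have h := (reducedData A B Q R su sx N).stage_add_quadForm (posDef_reducedData_R N hR) hX x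
    (-((reducedData A B Q R su sx N).gain X *ᵥ x))
  rw [reducedData_stage N hR, neg_add_cancel] at h
  have h0 : ∀ M : Matrix (Fin N.r) (Fin N.r) ℝ, quadForm M 0 = 0 := fun M => by simp [quadForm]
  rw [h0, add_zero] at h
  have h1 := quadForm_nonneg hR.posSemidef
    (-(kappa A B su sx *ᵥ x) + (onSupport su * N.N) *ᵥ
      (-((reducedData A B Q R su sx N).gain X *ᵥ x)))
  have h2 := quadForm_nonneg hX ((reducedData A B Q R su sx N).A *ᵥ x +
      (reducedData A B Q R su sx N).B *ᵥ (-((reducedData A B Q R su sx N).gain X *ᵥ x)))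
  linarith

theorem posSemidef_reducedData_riccati (hQ : Q.PosDef) (hR : R.PosDef)
    {X : Matrix (Fin n) (Fin n) ℝ} (hX : X.PosSemidef) :
    ((reducedData A B Q R su sx N).riccati X).PosSemidef :=
  posSemidef_of_quadForm_nonneg
    (LQData.transpose_riccati (transpose_reducedData_Q N hQ hR) (posDef_reducedData_R N hR) hX)
    fun x => (quadForm_nonneg hQ.posSemidef x).trans (quadForm_le_quadForm_riccati N hR hX x)

variable (A Q R) in
/-- The minimizing input of the Bellman step with value `X` at the next state, as a feedback in
the original input. -/
noncomputable def policy (X : Matrix (Fin n) (Fin n) ℝ) : Matrix (Fin m) (Fin n) ℝ :=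
  -(kappa A B su sx + onSupport su * N.N * (reducedData A B Q R su sx N).gain X)

theorem policy_mulVec (X : Matrix (Fin n) (Fin n) ℝ) (x : Fin n → ℝ) :
    policy A Q R N X *ᵥ x = -(kappa A B su sx *ᵥ x) + (onSupport su * N.N) *ᵥ
      (-((reducedData A B Q R su sx N).gain X *ᵥ x)) := by
  simp only [policy, neg_mulVec, add_mulVec, mulVec_neg, mulVec_mulVec]
  abel

theorem closedLoop_mulVec (X : Matrix (Fin n) (Fin n) ℝ) (x : Fin n → ℝ) :
    (reducedData A B Q R su sx N).closedLoop X *ᵥ x =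
      A *ᵥ x + B *ᵥ (policy A Q R N X *ᵥ x) := by
  rw [policy_mulVec, ← reducedData_dynamics (Q := Q) (R := R), LQData.closedLoop, sub_mulVec,
    mulVec_neg, mulVec_mulVec, sub_eq_add_neg]

end Reduced

/-! ### Dynamic programming along admissible trajectories -/

section Bellman

variable {n m : ℕ}

/-- `V` is the value function and `G` the unique optimal feedback of one step of the constrained
regulator problem, on the states supported in `sx`: the input is supported in `su`, the next state
in `sx'`, and the cost to go at the next state is `V'`. -/
structure BellmanStep (A : Matrix (Fin n) (Fin n) ℝ) (B : Matrix (Fin n) (Fin m) ℝ)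
    (Q : Matrix (Fin n) (Fin n) ℝ) (R : Matrix (Fin m) (Fin m) ℝ)
    (sx : Fin n → Bool) (su : Fin m → Bool) (sx' : Fin n → Bool)
    (V V' : Matrix (Fin n) (Fin n) ℝ) (G : Matrix (Fin m) (Fin n) ℝ) : Prop where
  le : ∀ x u, SupportedIn sx x → SupportedIn su u → SupportedIn sx' (A *ᵥ x + B *ᵥ u) →
    quadForm V x ≤ quadForm Q x + quadForm R u + quadForm V' (A *ᵥ x + B *ᵥ u)
  unique : ∀ x u, SupportedIn sx x → SupportedIn su u → SupportedIn sx' (A *ᵥ x + B *ᵥ u) →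
    quadForm V x = quadForm Q x + quadForm R u + quadForm V' (A *ᵥ x + B *ᵥ u) → u = G *ᵥ x
  supp_u : ∀ x, SupportedIn sx x → SupportedIn su (G *ᵥ x)
  supp_x : ∀ x, SupportedIn sx x → SupportedIn sx' (A *ᵥ x + B *ᵥ (G *ᵥ x))
  eq : ∀ x, SupportedIn sx x → quadForm V x =
    quadForm Q x + quadForm R (G *ᵥ x) + quadForm V' (A *ᵥ x + B *ᵥ (G *ᵥ x))

variable {A : Matrix (Fin n) (Fin n) ℝ} {B : Matrix (Fin n) (Fin m) ℝ}
  {Q : Matrix (Fin n) (Fin n) ℝ} {R : Matrix (Fin m) (Fin m) ℝ}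

theorem BellmanStep.congr {sx : Fin n → Bool} {su : Fin m → Bool} {sx' : Fin n → Bool}
    {V V' W : Matrix (Fin n) (Fin n) ℝ} {G H : Matrix (Fin m) (Fin n) ℝ}
    (h : BellmanStep A B Q R sx su sx' V V' G)
    (hV : ∀ x, SupportedIn sx x → quadForm W x = quadForm V x)
    (hG : ∀ x, SupportedIn sx x → H *ᵥ x = G *ᵥ x) :
    BellmanStep A B Q R sx su sx' W V' H where
  le x u hx hu hy := by rw [hV x hx]; exact h.le x u hx hu hy
  unique x u hx hu hy he := by
    rw [hG x hx]
    rw [hV x hx] at he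
    exact h.unique x u hx hu hy he
  supp_u x hx := by rw [hG x hx]; exact h.supp_u x hx
  supp_x x hx := by rw [hG x hx]; exact h.supp_x x hx
  eq x hx := by rw [hG x hx, hV x hx]; exact h.eq x hx

/-- The Riccati map and the gain of the reduced data solve the Bellman step, provided that every
state supported in `sx` has an admissible input. -/
theorem bellmanStep_reducedData (hR : R.PosDef)
    {sx : Fin n → Bool} {su : Fin m → Bool} {sx' : Fin n → Bool}
    (N : NullBasis (elimF B su sx'))
    (hcont : ∀ x, SupportedIn sx x → ∃ u, SupportedIn su u ∧ SupportedIn sx' (A *ᵥ x + B *ᵥ u))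
    {X : Matrix (Fin n) (Fin n) ℝ} (hX : X.PosSemidef) :
    BellmanStep A B Q R sx su sx' ((reducedData A B Q R su sx' N).riccati X) X
      (policy A Q R N X) := by
  have hRr := posDef_reducedData_R (A := A) (Q := Q) N hR
  have hW := LQData.posDef_hessian hRr hX
  -- The Bellman identity in the original input.
  have key : ∀ x r, quadForm Q x +
      quadForm R (-(kappa A B su sx' *ᵥ x) + (onSupport su * N.N) *ᵥ r) +
        quadForm X (A *ᵥ x + B *ᵥ (-(kappa A B su sx' *ᵥ x) + (onSupport su * N.N) *ᵥ r)) =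
      quadForm ((reducedData A B Q R su sx' N).riccati X) x +
        quadForm ((reducedData A B Q R su sx' N).R + (reducedData A B Q R su sx' N).Bᵀ * X *
          (reducedData A B Q R su sx' N).B)
          (r + (reducedData A B Q R su sx' N).gain X *ᵥ x) := by
    intro x r
    rw [← LQData.stage_add_quadForm _ hRr hX, reducedData_stage N hR, reducedData_dynamics]
  refine ⟨?_, ?_, ?_, ?_, ?_⟩
  · intro x u _ hu hy
    obtain ⟨r, rfl⟩ := exists_free_input N hu hy
    rw [key]
    exact le_add_of_nonneg_right (quadForm_nonneg hW.posSemidef _)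
  · intro x u _ hu hy he
    obtain ⟨r, rfl⟩ := exists_free_input N hu hy
    rw [key, left_eq_add] at he
    rw [policy_mulVec, eq_neg_of_add_eq_zero_left (eq_zero_of_quadForm_eq_zero hW he)]
  · intro x _
    rw [policy_mulVec]
    exact supportedIn_free_input N _ _
  · intro x hx
    obtain ⟨u, hu, hy⟩ := hcont x hx
    rw [policy_mulVec]
    exact supportedIn_next N hu hy _
  · intro x _
    rw [policy_mulVec, key, neg_add_cancel]
    simp [quadForm]

/-- A trajectory of the column dynamics that obeys the patterns `sx`, `su`. -/
structure IsTrajectory (A : Matrix (Fin n) (Fin n) ℝ) (B : Matrix (Fin n) (Fin m) ℝ)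
    (sx : ℕ → Fin n → Bool) (su : ℕ → Fin m → Bool)
    (x : ℕ → Fin n → ℝ) (u : ℕ → Fin m → ℝ) : Prop where
  step : ∀ t, x (t + 1) = A *ᵥ x t + B *ᵥ u t
  supp_x : ∀ t, SupportedIn (sx t) (x t)
  supp_u : ∀ t, SupportedIn (su t) (u t)

/-- The state trajectory generated by the feedbacks `G t`. -/
noncomputable def feedbackState (A : Matrix (Fin n) (Fin n) ℝ) (B : Matrix (Fin n) (Fin m) ℝ)
    (G : ℕ → Matrix (Fin m) (Fin n) ℝ) (ξ : Fin n → ℝ) : ℕ → Fin n → ℝ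
  | 0 => ξ
  | t + 1 => A *ᵥ feedbackState A B G ξ t + B *ᵥ (G t *ᵥ feedbackState A B G ξ t)

/-- Solution of the Bellman equations at all times, with value functions that are eventually
constant in time. -/
structure IsBellman (A : Matrix (Fin n) (Fin n) ℝ) (B : Matrix (Fin n) (Fin m) ℝ)
    (Q : Matrix (Fin n) (Fin n) ℝ) (R : Matrix (Fin m) (Fin m) ℝ)
    (sx : ℕ → Fin n → Bool) (su : ℕ → Fin m → Bool)
    (V : ℕ → Matrix (Fin n) (Fin n) ℝ) (G : ℕ → Matrix (Fin m) (Fin n) ℝ) : Prop where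
  posSemidef : ∀ t, (V t).PosSemidef
  eventually_const : ∃ W, ∀ᶠ t in Filter.atTop, V t = W
  step : ∀ t, BellmanStep A B Q R (sx t) (su t) (sx (t + 1)) (V t) (V (t + 1)) (G t)

variable {sx : ℕ → Fin n → Bool} {su : ℕ → Fin m → Bool}
  {V : ℕ → Matrix (Fin n) (Fin n) ℝ} {G : ℕ → Matrix (Fin m) (Fin n) ℝ}
  {x : ℕ → Fin n → ℝ} {u : ℕ → Fin m → ℝ}

theorem IsBellman.isTrajectory_feedback (h : IsBellman A B Q R sx su V G) {ξ : Fin n → ℝ}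
    (hξ : SupportedIn (sx 0) ξ) :
    IsTrajectory A B sx su (feedbackState A B G ξ) (fun t => G t *ᵥ feedbackState A B G ξ t) := by
  have hs : ∀ t, SupportedIn (sx t) (feedbackState A B G ξ t) := by
    intro t
    induction t with
    | zero => exact hξ
    | succ t ih => exact (h.step t).supp_x _ ih
  exact ⟨fun t => rfl, hs, fun t => (h.step t).supp_u _ (hs t)⟩

theorem IsBellman.quadForm_le_sum (h : IsBellman A B Q R sx su V G)
    (hx : IsTrajectory A B sx su x u) (T : ℕ) :
    quadForm (V 0) (x 0) ≤ ∑ t ∈ Finset.range T, (quadForm Q (x t) + quadForm R (u t)) +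
      quadForm (V T) (x T) := by
  induction T with
  | zero => simp
  | succ T ih =>
    have h1 := (h.step T).le (x T) (u T) (hx.supp_x T) (hx.supp_u T)
      (by rw [← hx.step]; exact hx.supp_x (T + 1))
    rw [← hx.step] at h1
    rw [Finset.sum_range_succ]
    linarith

theorem IsBellman.sum_feedback (h : IsBellman A B Q R sx su V G) {ξ : Fin n → ℝ}
    (hξ : SupportedIn (sx 0) ξ) (T : ℕ) :
    ∑ t ∈ Finset.range T, (quadForm Q (feedbackState A B G ξ t) +
      quadForm R (G t *ᵥ feedbackState A B G ξ t)) + quadForm (V T) (feedbackState A B G ξ T) =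
      quadForm (V 0) ξ := by
  have htr := h.isTrajectory_feedback hξ
  induction T with
  | zero => simp [feedbackState]
  | succ T ih =>
    have h1 := (h.step T).eq _ (htr.supp_x T)
    rw [Finset.sum_range_succ, ← ih, h1]
    rw [feedbackState]
    ring

theorem tendsto_zero_of_quadForm {x : ℕ → Fin n → ℝ} (hQ : Q.PosDef)
    (h : Filter.Tendsto (fun t => quadForm Q (x t)) Filter.atTop (nhds 0)) :
    Filter.Tendsto x Filter.atTop (nhds 0) := by
  -- With `S` the square root of `Q`, the vectors `S x t` tend to zero, and `S` is invertible.
  let S := CFC.sqrt Q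
  have hdet : IsUnit S.det := by
    have h1 := (isUnit_iff_isUnit_det _).1 hQ.isUnit
    rw [← CFC.sqrt_mul_sqrt_self Q (Matrix.nonneg_iff_posSemidef.2 hQ.posSemidef), det_mul] at h1
    exact isUnit_of_mul_isUnit_right h1
  have hq : ∀ t, quadForm Q (x t) = ∑ a, (S *ᵥ x t) a ^ 2 := fun t =>
    (sum_sq_sqrt_mulVec hQ.posSemidef (x t)).symm
  have hSx : Filter.Tendsto (fun t => S *ᵥ x t) Filter.atTop (nhds 0) := by
    rw [tendsto_pi_nhds]
    intro a
    have hsq : Filter.Tendsto (fun t => (S *ᵥ x t) a ^ 2) Filter.atTop (nhds 0) := by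
      refine squeeze_zero (fun t => sq_nonneg _) (fun t => ?_) h
      rw [hq]
      exact Finset.single_le_sum (f := fun a => (S *ᵥ x t) a ^ 2) (fun b _ => sq_nonneg _)
        (Finset.mem_univ a)
    have := hsq.sqrt
    simp only [Real.sqrt_sq_eq_abs, Real.sqrt_zero] at this
    exact (tendsto_zero_iff_abs_tendsto_zero _).2 this
  have hcont : Continuous fun v : Fin n → ℝ => S⁻¹ *ᵥ v := by fun_prop
  have := (hcont.tendsto 0).comp hSx
  simpa [Function.comp_def, mulVec_mulVec, nonsing_inv_mul _ hdet] using this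

theorem tendsto_quadForm_zero (W : Matrix (Fin n) (Fin n) ℝ) {x : ℕ → Fin n → ℝ}
    (h : Filter.Tendsto x Filter.atTop (nhds 0)) :
    Filter.Tendsto (fun t => quadForm W (x t)) Filter.atTop (nhds 0) := by
  have hcont : Continuous fun v : Fin n → ℝ => quadForm W v := by
    unfold quadForm
    fun_prop
  simpa [Function.comp_def, quadForm] using (hcont.tendsto 0).comp h

theorem IsBellman.tendsto_value_zero (h : IsBellman A B Q R sx su V G) (hQ : Q.PosDef)
    (hR : R.PosDef) (hc : Summable fun t => quadForm Q (x t) + quadForm R (u t)) :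
    Filter.Tendsto (fun t => quadForm (V t) (x t)) Filter.atTop (nhds 0) := by
  obtain ⟨W, hW⟩ := h.eventually_const
  have hq : Filter.Tendsto (fun t => quadForm Q (x t)) Filter.atTop (nhds 0) :=
    squeeze_zero (fun t => quadForm_nonneg hQ.posSemidef _)
      (fun t => le_add_of_nonneg_right (quadForm_nonneg hR.posSemidef _)) hc.tendsto_atTop_zero
  refine (tendsto_quadForm_zero W (tendsto_zero_of_quadForm hQ hq)).congr' ?_
  filter_upwards [hW] with t ht
  rw [ht]

theorem IsBellman.quadForm_le_tsum (h : IsBellman A B Q R sx su V G) (hQ : Q.PosDef)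
    (hR : R.PosDef) (hx : IsTrajectory A B sx su x u)
    (hc : Summable fun t => quadForm Q (x t) + quadForm R (u t)) :
    quadForm (V 0) (x 0) ≤ ∑' t, (quadForm Q (x t) + quadForm R (u t)) := by
  have h1 := hc.hasSum.tendsto_sum_nat.add (h.tendsto_value_zero hQ hR hc)
  rw [add_zero] at h1
  exact ge_of_tendsto' h1 (h.quadForm_le_sum hx)

theorem IsBellman.summable_feedback (h : IsBellman A B Q R sx su V G) (hQ : Q.PosDef)
    (hR : R.PosDef) {ξ : Fin n → ℝ} (hξ : SupportedIn (sx 0) ξ) :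
    Summable (fun t => quadForm Q (feedbackState A B G ξ t) +
      quadForm R (G t *ᵥ feedbackState A B G ξ t)) ∧
    ∑' t, (quadForm Q (feedbackState A B G ξ t) + quadForm R (G t *ᵥ feedbackState A B G ξ t)) ≤
      quadForm (V 0) ξ := by
  have h0 : ∀ t, 0 ≤ quadForm Q (feedbackState A B G ξ t) +
      quadForm R (G t *ᵥ feedbackState A B G ξ t) := fun t =>
    add_nonneg (quadForm_nonneg hQ.posSemidef _) (quadForm_nonneg hR.posSemidef _)
  have hle : ∀ T, ∑ t ∈ Finset.range T, (quadForm Q (feedbackState A B G ξ t) +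
      quadForm R (G t *ᵥ feedbackState A B G ξ t)) ≤ quadForm (V 0) ξ := fun T => by
    rw [← h.sum_feedback hξ T]
    exact le_add_of_nonneg_right (quadForm_nonneg (h.posSemidef T) _)
  exact ⟨summable_of_sum_range_le h0 hle, Real.tsum_le_of_sum_range_le h0 hle⟩

/-- A trajectory whose cost does not exceed the value is generated by the optimal feedback. -/
theorem IsBellman.eq_feedback (h : IsBellman A B Q R sx su V G) (hQ : Q.PosDef)
    (hR : R.PosDef) (hx : IsTrajectory A B sx su x u)
    (hc : Summable fun t => quadForm Q (x t) + quadForm R (u t))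
    (hle : ∑' t, (quadForm Q (x t) + quadForm R (u t)) ≤ quadForm (V 0) (x 0)) (t : ℕ) :
    x t = feedbackState A B G (x 0) t ∧ u t = G t *ᵥ feedbackState A B G (x 0) t := by
  -- The Bellman defects along the trajectory are nonnegative and have a sum `≤ 0`.
  let g : ℕ → ℝ := fun t => quadForm Q (x t) + quadForm R (u t) +
    quadForm (V (t + 1)) (x (t + 1)) - quadForm (V t) (x t)
  have hg0 : ∀ t, 0 ≤ g t := by
    intro t
    have h1 := (h.step t).le (x t) (u t) (hx.supp_x t) (hx.supp_u t)
      (by rw [← hx.step]; exact hx.supp_x (t + 1))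
    rw [← hx.step] at h1
    exact sub_nonneg.2 h1
  have hsum : ∀ T, ∑ t ∈ Finset.range T, g t =
      ∑ t ∈ Finset.range T, (quadForm Q (x t) + quadForm R (u t)) + quadForm (V T) (x T) -
        quadForm (V 0) (x 0) := by
    intro T
    induction T with
    | zero => simp
    | succ T ih =>
      rw [Finset.sum_range_succ, ih, Finset.sum_range_succ]
      simp only [g]
      ring
  have hlim : HasSum g
      (∑' t, (quadForm Q (x t) + quadForm R (u t)) - quadForm (V 0) (x 0)) := by
    rw [hasSum_iff_tendsto_nat_of_nonneg hg0]
    simp only [hsum]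
    have h1 := (hc.hasSum.tendsto_sum_nat.add (h.tendsto_value_zero hQ hR hc)).sub_const
      (quadForm (V 0) (x 0))
    rwa [add_zero] at h1
  have hg : ∀ t, g t = 0 := fun t => le_antisymm
    ((le_hasSum hlim t fun s _ => hg0 s).trans (sub_nonpos.2 hle)) (hg0 t)
  have hu : ∀ t, u t = G t *ᵥ x t := by
    intro t
    refine (h.step t).unique (x t) (u t) (hx.supp_x t) (hx.supp_u t)
      (by rw [← hx.step]; exact hx.supp_x (t + 1)) ?_
    rw [← hx.step]
    exact (sub_eq_zero.1 (hg t)).symm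
  have hxt : ∀ t, x t = feedbackState A B G (x 0) t := by
    intro t
    induction t with
    | zero => rfl
    | succ t ih => rw [hx.step, hu, ih]; rfl
  exact ⟨hxt t, by rw [hu, ← hxt t]⟩

end Bellman

/-! ### The stationary Riccati equation -/

namespace LQData

variable {σ ρ : Type} [Fintype σ] [Fintype ρ] [DecidableEq ρ]

theorem quadForm_riccati_mono (D : LQData σ ρ) (hR : D.R.PosDef) {X Y : Matrix σ σ ℝ}
    (hX : X.PosSemidef) (hY : Y.PosSemidef) (h : ∀ x, quadForm X x ≤ quadForm Y x) (x : σ → ℝ) :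
    quadForm (D.riccati X) x ≤ quadForm (D.riccati Y) x := by
  have h1 := D.stage_add_quadForm hR hX x (-(D.gain Y *ᵥ x))
  have h2 := D.stage_add_quadForm hR hY x (-(D.gain Y *ᵥ x))
  have h3 := quadForm_nonneg (posDef_hessian hR hX).posSemidef (-(D.gain Y *ᵥ x) + D.gain X *ᵥ x)
  have h4 := h (D.A *ᵥ x + D.B *ᵥ (-(D.gain Y *ᵥ x)))
  rw [neg_add_cancel] at h2
  have h0 : quadForm (D.R + D.Bᵀ * Y * D.B) 0 = 0 := by simp [quadForm]
  linarith

theorem continuousAt_riccati (D : LQData σ ρ) (hR : D.R.PosDef) {X : Matrix σ σ ℝ}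
    (hX : X.PosSemidef) : ContinuousAt D.riccati X := by
  have hdet : IsUnit (D.R + D.Bᵀ * X * D.B).det :=
    (isUnit_iff_isUnit_det _).1 (posDef_hessian hR hX).isUnit
  have hinv : ContinuousAt (fun Y : Matrix σ σ ℝ => (D.R + D.Bᵀ * Y * D.B)⁻¹) X := by
    have h1 : ContinuousAt (fun W : Matrix ρ ρ ℝ => W⁻¹) (D.R + D.Bᵀ * X * D.B) := by
      refine continuousAt_matrix_inv _ ?_
      rw [Ring.inverse_eq_inv']
      exact continuousAt_inv₀ hdet.ne_zero
    have h2 : Continuous fun Y : Matrix σ σ ℝ => D.R + D.Bᵀ * Y * D.B := by fun_prop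
    exact ContinuousAt.comp (f := fun Y : Matrix σ σ ℝ => D.R + D.Bᵀ * Y * D.B) h1
      h2.continuousAt
  have h3 : Continuous fun Y : Matrix σ σ ℝ => D.Q + D.Aᵀ * Y * D.A := by fun_prop
  have h4 : Continuous fun Y : Matrix σ σ ℝ => D.Aᵀ * Y * D.B + D.Zᵀ := by fun_prop
  have h5 : Continuous fun Y : Matrix σ σ ℝ => D.Bᵀ * Y * D.A + D.Z := by fun_prop
  have h6 : ContinuousAt (fun Y : Matrix σ σ ℝ => (D.Aᵀ * Y * D.B + D.Zᵀ) *
      (D.R + D.Bᵀ * Y * D.B)⁻¹ * (D.Bᵀ * Y * D.A + D.Z)) X := by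
    have hmul : Continuous fun M : Matrix σ ρ ℝ × Matrix ρ ρ ℝ × Matrix ρ σ ℝ =>
        M.1 * M.2.1 * M.2.2 := by fun_prop
    exact ContinuousAt.comp (f := fun Y : Matrix σ σ ℝ => (D.Aᵀ * Y * D.B + D.Zᵀ,
      (D.R + D.Bᵀ * Y * D.B)⁻¹, D.Bᵀ * Y * D.A + D.Z)) hmul.continuousAt
      (h4.continuousAt.prodMk (hinv.prodMk h5.continuousAt))
  exact h3.continuousAt.sub h6

end LQData

/-- A monotone bounded sequence of symmetric matrices converges. -/
theorem exists_tendsto_of_quadForm_mono {σ : Type} [Fintype σ] {P : ℕ → Matrix σ σ ℝ}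
    (hs : ∀ j, (P j)ᵀ = P j) (hm : ∀ j x, quadForm (P j) x ≤ quadForm (P (j + 1)) x)
    (hb : ∀ x, ∃ C, ∀ j, quadForm (P j) x ≤ C) :
    ∃ L, Filter.Tendsto P Filter.atTop (nhds L) := by
  classical
  have hq : ∀ x, ∃ l, Filter.Tendsto (fun j => quadForm (P j) x) Filter.atTop (nhds l) := by
    intro x
    obtain ⟨C, hC⟩ := hb x
    exact ⟨_, tendsto_atTop_ciSup (monotone_nat_of_le_succ fun j => hm j x)
      ⟨C, by rintro _ ⟨j, rfl⟩; exact hC j⟩⟩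
  choose l hl using hq
  refine ⟨Matrix.of fun a b => (l (Pi.single a 1 + Pi.single b 1) - l (Pi.single a 1) -
    l (Pi.single b 1)) / 2, ?_⟩
  refine tendsto_pi_nhds.2 fun a => tendsto_pi_nhds.2 fun b => ?_
  have h := (((hl (Pi.single a 1 + Pi.single b 1)).sub (hl (Pi.single a 1))).sub
    (hl (Pi.single b 1))).div_const 2
  refine h.congr fun j => ?_
  rw [← dotProduct_mulVec_eq_quadForm (hs j)]
  simp

theorem tendsto_quadForm_matrix {σ : Type} [Fintype σ] {P : ℕ → Matrix σ σ ℝ} {L : Matrix σ σ ℝ}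
    (h : Filter.Tendsto P Filter.atTop (nhds L)) (x : σ → ℝ) :
    Filter.Tendsto (fun j => quadForm (P j) x) Filter.atTop (nhds (quadForm L x)) := by
  have hc : Continuous fun M : Matrix σ σ ℝ => quadForm M x := by
    unfold quadForm
    fun_prop
  exact (hc.tendsto L).comp h

section Static

variable {n m : ℕ} {A : Matrix (Fin n) (Fin n) ℝ} {B : Matrix (Fin n) (Fin m) ℝ}
  {Q : Matrix (Fin n) (Fin n) ℝ} {R : Matrix (Fin m) (Fin m) ℝ}
  {su : Fin m → Bool} {sx : Fin n → Bool} (N : NullBasis (elimF B su sx))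

theorem posSemidef_zeroExtend {X : Matrix {a // sx a = true} {a // sx a = true} ℝ}
    (hX : X.PosSemidef) : (onSupport sx * X * (onSupport sx)ᵀ).PosSemidef :=
  hX.conj_transpose' _

theorem quadForm_zeroExtend (X : Matrix {a // sx a = true} {a // sx a = true} ℝ)
    (ξ : {a // sx a = true} → ℝ) :
    quadForm (onSupport sx * X * (onSupport sx)ᵀ) (onSupport sx *ᵥ ξ) = quadForm X ξ := by
  rw [quadForm_conj', mulVec_mulVec, transpose_onSupport_mul_onSupport, one_mulVec]

theorem posSemidef_staticData_riccati (hQ : Q.PosDef) (hR : R.PosDef)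
    {X : Matrix {a // sx a = true} {a // sx a = true} ℝ} (hX : X.PosSemidef) :
    ((staticData A B Q R su sx N).riccati X).PosSemidef := by
  rw [staticData, LQData.riccati_restrict]
  exact (posSemidef_reducedData_riccati N hQ hR (posSemidef_zeroExtend hX)).conj_transpose _

/-- On the states in the pattern, the static Riccati map is the Riccati map of the reduced data. -/
theorem quadForm_staticData_riccati (X : Matrix {a // sx a = true} {a // sx a = true} ℝ)
    {x : Fin n → ℝ} (hx : SupportedIn sx x) :
    quadForm ((staticData A B Q R su sx N).riccati X) ((onSupport sx)ᵀ *ᵥ x) =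
      quadForm ((reducedData A B Q R su sx N).riccati (onSupport sx * X * (onSupport sx)ᵀ)) x := by
  rw [staticData, LQData.riccati_restrict, quadForm_conj, onSupport_mulVec_transpose_mulVec hx]

variable (A Q R) in
/-- The stationary feedback in the original input, extended by zero outside `sx`. -/
noncomputable def staticPolicy (X : Matrix {a // sx a = true} {a // sx a = true} ℝ) :
    Matrix (Fin m) (Fin n) ℝ :=
  -(kappa A B su sx * onSupport sx +
      onSupport su * N.N * (staticData A B Q R su sx N).gain X) * (onSupport sx)ᵀ

theorem staticPolicy_eq (X : Matrix {a // sx a = true} {a // sx a = true} ℝ) :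
    staticPolicy A Q R N X = policy A Q R N (onSupport sx * X * (onSupport sx)ᵀ) *
      onSupport sx * (onSupport sx)ᵀ := by
  rw [staticPolicy, policy, staticData, LQData.gain_restrict]
  simp only [Matrix.neg_mul, Matrix.add_mul, Matrix.mul_assoc]

theorem staticPolicy_mulVec (X : Matrix {a // sx a = true} {a // sx a = true} ℝ)
    {x : Fin n → ℝ} (hx : SupportedIn sx x) :
    staticPolicy A Q R N X *ᵥ x =
      policy A Q R N (onSupport sx * X * (onSupport sx)ᵀ) *ᵥ x := by
  rw [staticPolicy_eq, ← mulVec_mulVec, ← mulVec_mulVec, onSupport_mulVec_transpose_mulVec hx]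

theorem bellmanStep_stationary (hR : R.PosDef)
    (hcont : ∀ x, SupportedIn sx x → ∃ u, SupportedIn su u ∧ SupportedIn sx (A *ᵥ x + B *ᵥ u))
    {X : Matrix {a // sx a = true} {a // sx a = true} ℝ}
    (hX : IsStationarySolution A B Q R su sx N X) :
    BellmanStep A B Q R sx su sx (onSupport sx * X * (onSupport sx)ᵀ)
      (onSupport sx * X * (onSupport sx)ᵀ) (staticPolicy A Q R N X) := by
  refine (bellmanStep_reducedData hR N hcont (posSemidef_zeroExtend hX.1.posSemidef)).congr
    (fun x hx => ?_) fun x hx => staticPolicy_mulVec N X hx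
  rw [← quadForm_staticData_riccati N X hx, hX.2, quadForm_conj']

theorem isBellman_stationary (hR : R.PosDef)
    (hcont : ∀ x, SupportedIn sx x → ∃ u, SupportedIn su u ∧ SupportedIn sx (A *ᵥ x + B *ᵥ u))
    {X : Matrix {a // sx a = true} {a // sx a = true} ℝ}
    (hX : IsStationarySolution A B Q R su sx N X) :
    IsBellman A B Q R (fun _ => sx) (fun _ => su)
      (fun _ => onSupport sx * X * (onSupport sx)ᵀ) (fun _ => staticPolicy A Q R N X) :=
  ⟨fun _ => posSemidef_zeroExtend hX.1.posSemidef, ⟨_, Filter.Eventually.of_forall fun _ => rfl⟩,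
    fun _ => bellmanStep_stationary N hR hcont hX⟩

/-- The closed loop of one solution is a competitor for any other one. -/
theorem IsStationarySolution.quadForm_le (hQ : Q.PosDef) (hR : R.PosDef)
    (hcont : ∀ x, SupportedIn sx x → ∃ u, SupportedIn su u ∧ SupportedIn sx (A *ᵥ x + B *ᵥ u))
    {X Y : Matrix {a // sx a = true} {a // sx a = true} ℝ}
    (hX : IsStationarySolution A B Q R su sx N X) (hY : IsStationarySolution A B Q R su sx N Y)
    (ξ : {a // sx a = true} → ℝ) : quadForm X ξ ≤ quadForm Y ξ := by
  have hBX := isBellman_stationary N hR hcont hX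
  have hBY := isBellman_stationary N hR hcont hY
  have hξ := supportedIn_onSupport_mulVec sx ξ
  have h := hBX.quadForm_le_tsum hQ hR (hBY.isTrajectory_feedback hξ)
    (hBY.summable_feedback hQ hR hξ).1
  have h2 := h.trans (hBY.summable_feedback hQ hR hξ).2
  rwa [feedbackState, quadForm_zeroExtend, quadForm_zeroExtend] at h2

/-- Uniqueness of the stationary solution, by comparison of the quadratic forms both ways. -/
theorem IsStationarySolution.unique (hQ : Q.PosDef) (hR : R.PosDef)
    (hcont : ∀ x, SupportedIn sx x → ∃ u, SupportedIn su u ∧ SupportedIn sx (A *ᵥ x + B *ᵥ u))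
    {X Y : Matrix {a // sx a = true} {a // sx a = true} ℝ}
    (hX : IsStationarySolution A B Q R su sx N X) (hY : IsStationarySolution A B Q R su sx N Y) :
    X = Y :=
  eq_of_quadForm_eq hX.1.posSemidef.transpose_eq hY.1.posSemidef.transpose_eq fun ξ =>
    le_antisymm (hX.quadForm_le N hQ hR hcont hY ξ) (hY.quadForm_le N hQ hR hcont hX ξ)

theorem posSemidef_iterate_riccati (hQ : Q.PosDef) (hR : R.PosDef) (j : ℕ) :
    ((staticData A B Q R su sx N).riccati^[j] 0).PosSemidef := by
  induction j with
  | zero => simpa using PosSemidef.zero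
  | succ j ih =>
    rw [Function.iterate_succ_apply']
    exact posSemidef_staticData_riccati N hQ hR ih

/-- Value iteration bounds the cost of every trajectory from below. -/
theorem quadForm_iterate_riccati_le (hQ : Q.PosDef) (hR : R.PosDef) (j : ℕ)
    {x : ℕ → Fin n → ℝ} {u : ℕ → Fin m → ℝ}
    (hx : IsTrajectory A B (fun _ => sx) (fun _ => su) x u) :
    quadForm ((staticData A B Q R su sx N).riccati^[j] 0) ((onSupport sx)ᵀ *ᵥ x 0) ≤
      ∑ t ∈ Finset.range j, (quadForm Q (x t) + quadForm R (u t)) := by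
  induction j generalizing x u with
  | zero => simp [quadForm]
  | succ j ih =>
    have hP := posSemidef_iterate_riccati (A := A) (B := B) N hQ hR j
    have htail : IsTrajectory A B (fun _ => sx) (fun _ => su)
        (fun t => x (t + 1)) (fun t => u (t + 1)) :=
      ⟨fun t => hx.step (t + 1), fun t => hx.supp_x (t + 1), fun t => hx.supp_u (t + 1)⟩
    rw [Function.iterate_succ_apply', quadForm_staticData_riccati N _ (hx.supp_x 0),
      Finset.sum_range_succ']
    obtain ⟨r, hr⟩ := exists_free_input (A := A) N (hx.supp_u 0)
      (by rw [← hx.step 0]; exact hx.supp_x 1)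
    have h1 := (reducedData A B Q R su sx N).stage_add_quadForm (posDef_reducedData_R N hR)
      (posSemidef_zeroExtend hP) (x 0) r
    rw [reducedData_stage N hR, reducedData_dynamics, ← hr, ← hx.step, quadForm_conj' _ _ (x 1)]
      at h1
    have h2 := quadForm_nonneg (LQData.posDef_hessian
      (D := reducedData A B Q R su sx N) (posDef_reducedData_R N hR)
      (posSemidef_zeroExtend hP)).posSemidef (r + (reducedData A B Q R su sx N).gain
        (onSupport sx * ((staticData A B Q R su sx N).riccati^[j] 0) * (onSupport sx)ᵀ) *ᵥ x 0)
    have h3 := ih htail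
    linarith

/-- Value iteration from `0` converges to a stationary solution; it is positive definite since the
Riccati map dominates `Q`. -/
theorem exists_isStationarySolution (hQ : Q.PosDef) (hR : R.PosDef)
    (hadm : ∀ ξ, SupportedIn sx ξ → ∃ x u, x 0 = ξ ∧
      IsTrajectory A B (fun _ => sx) (fun _ => su) x u ∧
      Summable fun t => quadForm Q (x t) + quadForm R (u t)) :
    ∃ X, IsStationarySolution A B Q R su sx N X := by
  let D := staticData A B Q R su sx N
  let P : ℕ → Matrix {a // sx a = true} {a // sx a = true} ℝ := fun j => D.riccati^[j] 0
  have hDR : D.R.PosDef := posDef_reducedData_R (A := A) (Q := Q) N hR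
  have hPsucc : ∀ j, P (j + 1) = D.riccati (P j) := fun j => Function.iterate_succ_apply' _ _ _
  have hP : ∀ j, (P j).PosSemidef := posSemidef_iterate_riccati N hQ hR
  have hmono : ∀ j x, quadForm (P j) x ≤ quadForm (P (j + 1)) x := by
    intro j
    induction j with
    | zero =>
      intro x
      have : quadForm (P 0) x = 0 := by simp [P, quadForm]
      rw [this]
      exact quadForm_nonneg (hP 1) x
    | succ j ih =>
      intro x
      rw [hPsucc, hPsucc (j + 1)]
      exact D.quadForm_riccati_mono hDR (hP j) (hP (j + 1)) ih x
  have hbound : ∀ ξ, ∃ C, ∀ j, quadForm (P j) ξ ≤ C := by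
    intro ξ
    obtain ⟨x, u, hx0, hx, hc⟩ := hadm _ (supportedIn_onSupport_mulVec sx ξ)
    refine ⟨_, fun j => ((quadForm_iterate_riccati_le N hQ hR j hx).trans
      (hc.sum_le_tsum _ fun t _ => add_nonneg (quadForm_nonneg hQ.posSemidef _)
        (quadForm_nonneg hR.posSemidef _))).trans_eq' ?_⟩
    rw [hx0, mulVec_mulVec, transpose_onSupport_mul_onSupport, one_mulVec]
  obtain ⟨X, hX⟩ := exists_tendsto_of_quadForm_mono (fun j => (hP j).transpose_eq) hmono hbound
  have hXs : Xᵀ = X := by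
    have h1 : Filter.Tendsto (fun j => (P j)ᵀ) Filter.atTop (nhds Xᵀ) :=
      (continuous_id.matrix_transpose.tendsto X).comp hX
    refine tendsto_nhds_unique (h1.congr fun j => (hP j).transpose_eq) hX
  have hXpsd : X.PosSemidef := posSemidef_of_quadForm_nonneg hXs fun x =>
    ge_of_tendsto' (tendsto_quadForm_matrix hX x) fun j => quadForm_nonneg (hP j) x
  have hfix : D.riccati X = X := by
    have h1 : Filter.Tendsto (fun j => D.riccati (P j)) Filter.atTop (nhds (D.riccati X)) :=
      (D.continuousAt_riccati hDR hXpsd).tendsto.comp hX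
    refine tendsto_nhds_unique (h1.congr fun j => (hPsucc j).symm) ?_
    exact hX.comp (Filter.tendsto_add_atTop_nat 1)
  refine ⟨X, posDef_of_quadForm_pos hXs fun ξ hξ => ?_, hfix⟩
  have hE : onSupport sx *ᵥ ξ ≠ 0 := fun h =>
    hξ (onSupport_mulVec_injective sx (h.trans (mulVec_zero _).symm))
  have h1 := quadForm_staticData_riccati (A := A) (Q := Q) (R := R) N X
    (supportedIn_onSupport_mulVec sx ξ)
  rw [mulVec_mulVec, transpose_onSupport_mul_onSupport, one_mulVec] at h1
  change quadForm (D.riccati X) ξ = _ at h1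
  rw [hfix] at h1
  rw [h1]
  exact (quadForm_pos hQ hE).trans_le
    (quadForm_le_quadForm_riccati N hR (posSemidef_zeroExtend hXpsd) _)

end Static

end SLS

namespace TransferMatrix

/-! ### Expansion of rational functions at infinity -/

/-- A polynomial in `z`, as a Laurent series in `1/z`. -/
noncomputable def polyAtInfinity : Polynomial ℝ →+* LaurentSeries ℝ :=
  Polynomial.eval₂RingHom HahnSeries.C (HahnSeries.single (-1 : ℤ) (1 : ℝ))

theorem polyAtInfinity_coeff (p : Polynomial ℝ) (j : ℤ) :
    (polyAtInfinity p).coeff j = if j ≤ 0 then p.coeff (-j).toNat else 0 := by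
  induction p using Polynomial.induction_on' with
  | add p q hp hq =>
    rw [map_add, HahnSeries.coeff_add, hp, hq]
    split_ifs <;> simp
  | monomial k a =>
    have h : polyAtInfinity (Polynomial.monomial k a) = HahnSeries.single (-(k : ℤ)) a := by
      simp [polyAtInfinity, HahnSeries.C_apply, HahnSeries.single_mul_single]
    rw [h, HahnSeries.coeff_single, Polynomial.coeff_monomial]
    split_ifs <;> first | rfl | omega

theorem polyAtInfinity_injective : Function.Injective polyAtInfinity := by
  rw [injective_iff_map_eq_zero]
  intro p hp
  ext k
  have h := polyAtInfinity_coeff p (-(k : ℤ))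
  rw [hp] at h
  simpa using h.symm

theorem order_polyAtInfinity {p : Polynomial ℝ} (hp : p ≠ 0) :
    (polyAtInfinity p).order = -(p.natDegree : ℤ) := by
  apply le_antisymm
  · apply HahnSeries.order_le_of_coeff_ne_zero
    rw [polyAtInfinity_coeff]
    simpa using hp
  · rw [HahnSeries.le_order_iff_forall
      ((map_ne_zero_iff _ polyAtInfinity_injective).2 hp)]
    intro j hj
    rw [polyAtInfinity_coeff]
    split_ifs
    · exact Polynomial.coeff_eq_zero_of_natDegree_lt (by omega)
    · rfl

/-- The expansion at infinity, as a homomorphism from rational functions in `z` to Laurent series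
in `1/z`. -/
noncomputable def expansion : RatFunc ℝ →+* LaurentSeries ℝ :=
  RatFunc.liftRingHom polyAtInfinity (nonZeroDivisors_le_comap_nonZeroDivisors_of_injective _
    polyAtInfinity_injective)

theorem expansion_eq_div (f : RatFunc ℝ) :
    expansion f = polyAtInfinity f.num / polyAtInfinity f.denom := by
  conv_lhs => rw [← RatFunc.num_div_denom f]
  rw [expansion, RatFunc.liftRingHom_apply_div]

theorem kernelScalar_eq_coeff (f : RatFunc ℝ) (k : ℤ) :
    kernelScalar f k = (expansion f).coeff k := by
  rw [expansion_eq_div]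
  rfl

theorem expansion_C (a : ℝ) : expansion (RatFunc.C a) = HahnSeries.C a := by
  rw [← RatFunc.algebraMap_C, expansion, RatFunc.liftRingHom_algebraMap]
  simp [polyAtInfinity]

theorem expansion_X : expansion RatFunc.X = HahnSeries.single (-1 : ℤ) (1 : ℝ) := by
  rw [← RatFunc.algebraMap_X, expansion, RatFunc.liftRingHom_algebraMap]
  simp [polyAtInfinity]

theorem kernelScalar_ext {f g : RatFunc ℝ} (h : ∀ k, kernelScalar f k = kernelScalar g k) :
    f = g := by
  apply expansion.injective
  ext k
  simpa only [kernelScalar_eq_coeff] using h k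

theorem kernelScalar_X_mul (f : RatFunc ℝ) (k : ℤ) :
    kernelScalar (RatFunc.X * f) k = kernelScalar f (k + 1) := by
  rw [kernelScalar_eq_coeff, kernelScalar_eq_coeff, map_mul, expansion_X,
    HahnSeries.coeff_single_mul]
  simp

theorem kernelScalar_C_mul (a : ℝ) (f : RatFunc ℝ) (k : ℤ) :
    kernelScalar (RatFunc.C a * f) k = a * kernelScalar f k := by
  rw [kernelScalar_eq_coeff, kernelScalar_eq_coeff, map_mul, expansion_C,
    HahnSeries.C_apply, HahnSeries.coeff_single_mul]
  simp

theorem kernelScalar_C (a : ℝ) (k : ℤ) :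
    kernelScalar (RatFunc.C a) k = if k = 0 then a else 0 := by
  rw [kernelScalar_eq_coeff, expansion_C, HahnSeries.C_apply, HahnSeries.coeff_single]
  split_ifs <;> rfl

theorem kernelScalar_sub (f g : RatFunc ℝ) (k : ℤ) :
    kernelScalar (f - g) k = kernelScalar f k - kernelScalar g k := by
  simp [kernelScalar_eq_coeff]

theorem kernelScalar_sum {ι : Type} (s : Finset ι) (f : ι → RatFunc ℝ) (k : ℤ) :
    kernelScalar (∑ i ∈ s, f i) k = ∑ i ∈ s, kernelScalar (f i) k := by
  simp [kernelScalar_eq_coeff, HahnSeries.coeff_sum]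

/-- Properness is the absence of positive powers of `z` in the expansion at infinity. -/
theorem natDegree_num_le_iff (f : RatFunc ℝ) :
    f.num.natDegree ≤ f.denom.natDegree ↔ ∀ k < 0, kernelScalar f k = 0 := by
  rcases eq_or_ne f 0 with rfl | hf
  · simp [kernelScalar_eq_coeff]
  have hn := RatFunc.num_ne_zero hf
  have hd := RatFunc.denom_ne_zero f
  have he : expansion f ≠ 0 := (map_ne_zero expansion).2 hf
  have hmul : expansion f * polyAtInfinity f.denom = polyAtInfinity f.num := by
    rw [expansion_eq_div, div_mul_cancel₀]
    exact (map_ne_zero_iff _ polyAtInfinity_injective).2 hd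
  have hord : (expansion f).order = f.denom.natDegree - f.num.natDegree := by
    have h := congrArg HahnSeries.order hmul
    rw [HahnSeries.order_mul he ((map_ne_zero_iff _ polyAtInfinity_injective).2 hd),
      order_polyAtInfinity hd, order_polyAtInfinity hn] at h
    omega
  simp only [kernelScalar_eq_coeff]
  rw [← HahnSeries.le_order_iff_forall he, hord]
  omega

/-! ### Kernels of transfer matrices -/

variable {p q r s : Type}

/-- The coefficient of `z⁻ᵏ` in the expansion of `G` at infinity, for every integer `k`. -/
noncomputable def coeffMatrix (G : TransferMatrix p q) (k : ℤ) : Matrix p q ℝ :=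
  G.map fun f => kernelScalar f k

theorem kernel_eq_coeffMatrix (G : TransferMatrix p q) (k : ℕ) :
    kernel G k = coeffMatrix G k := rfl

theorem coeffMatrix_ext {G H : TransferMatrix p q}
    (h : ∀ k, coeffMatrix G k = coeffMatrix H k) : G = H := by
  ext a b : 2
  exact kernelScalar_ext fun k => congrFun (congrFun (h k) a) b

theorem coeffMatrix_sub (G H : TransferMatrix p q) (k : ℤ) :
    coeffMatrix (G - H) k = coeffMatrix G k - coeffMatrix H k := by
  ext a b
  exact kernelScalar_sub _ _ _

theorem coeffMatrix_const_mul [Fintype p] (M : Matrix r p ℝ) (G : TransferMatrix p q) (k : ℤ) :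
    coeffMatrix (const M * G) k = M * coeffMatrix G k := by
  ext a b
  simp [coeffMatrix, const, Matrix.mul_apply, kernelScalar_sum, kernelScalar_C_mul]

theorem coeffMatrix_const (M : Matrix p q ℝ) (k : ℤ) :
    coeffMatrix (const M) k = if k = 0 then M else 0 := by
  ext a b
  simp only [coeffMatrix, const, Matrix.map_apply, kernelScalar_C]
  split_ifs <;> rfl

theorem const_one [DecidableEq p] : const (1 : Matrix p p ℝ) = 1 := by
  simp [const]

theorem const_zero : const (0 : Matrix p q ℝ) = 0 := by
  ext; simp [const]

theorem coeffMatrix_zSub_mul [Fintype s] [DecidableEq s] (A : Matrix s s ℝ)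
    (G : TransferMatrix s q) (k : ℤ) :
    coeffMatrix (zSub A * G) k = coeffMatrix G (k + 1) - A * coeffMatrix G k := by
  rw [zSub, Matrix.sub_mul, coeffMatrix_sub, coeffMatrix_const_mul]
  congr 1
  ext a b
  simp [coeffMatrix, kernelScalar_X_mul]

theorem IsInvZRHInf.coeffMatrix_eq_zero {G : TransferMatrix p q} (h : IsInvZRHInf G) {k : ℤ}
    (hk : k ≤ 0) : coeffMatrix G k = 0 := by
  ext a b
  have h1 := (natDegree_num_le_iff _).1 (h a b).1 (k - 1) (by omega)
  rw [Matrix.smul_apply, smul_eq_mul, kernelScalar_X_mul, sub_add_cancel] at h1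
  exact h1

/-- Two strictly proper transfer matrices are equal if their kernels agree. -/
theorem IsInvZRHInf.ext {G H : TransferMatrix p q} (hG : IsInvZRHInf G) (hH : IsInvZRHInf H)
    (h : ∀ t : ℕ, kernel G (t + 1) = kernel H (t + 1)) : G = H := by
  refine coeffMatrix_ext fun k => ?_
  rcases le_or_gt k 0 with hk | hk
  · rw [hG.coeffMatrix_eq_zero hk, hH.coeffMatrix_eq_zero hk]
  · obtain ⟨t, rfl⟩ : ∃ t : ℕ, k = ((t + 1 : ℕ) : ℤ) := ⟨(k - 1).toNat, by omega⟩
    exact h t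

/-! ### State-space realizations -/

section Realization

variable [Fintype s] [DecidableEq s]

theorem zSub_eq_map_charmatrix (A : Matrix s s ℝ) :
    zSub A = (charmatrix A).map (algebraMap (Polynomial ℝ) (RatFunc ℝ)) := by
  ext a b : 2
  by_cases h : a = b
  · subst h
    simp [zSub, const]
  · simp [zSub, const, h]

theorem det_zSub (A : Matrix s s ℝ) :
    (zSub A).det = algebraMap (Polynomial ℝ) (RatFunc ℝ) A.charpoly := by
  rw [zSub_eq_map_charmatrix, charpoly, RingHom.map_det]
  rfl

theorem isUnit_det_zSub (A : Matrix s s ℝ) : IsUnit (zSub A).det := by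
  rw [det_zSub, isUnit_iff_ne_zero]
  exact (map_ne_zero_iff _ (RatFunc.algebraMap_injective ℝ)).2 A.charpoly_monic.ne_zero

theorem coeffMatrix_resolvent_add_one (A : Matrix s s ℝ) (B : Matrix s q ℝ) (k : ℤ) :
    coeffMatrix ((zSub A)⁻¹ * const B) (k + 1) =
      A * coeffMatrix ((zSub A)⁻¹ * const B) k + if k = 0 then B else 0 := by
  have h := coeffMatrix_zSub_mul A ((zSub A)⁻¹ * const B) k
  rw [mul_nonsing_inv_cancel_left _ _ (isUnit_det_zSub A), coeffMatrix_const] at h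
  rw [h]
  abel

/-- The Laurent coefficients of `(z I - A)⁻¹ B` vanish for negative exponents, since there are
only finitely many such coefficients and they satisfy `h[k + 1] = A h[k]` for `k < 0`. -/
theorem coeffMatrix_resolvent_of_nonpos [Finite q] (A : Matrix s s ℝ) (B : Matrix s q ℝ) {k : ℤ}
    (hk : k ≤ 0) : coeffMatrix ((zSub A)⁻¹ * const B) k = 0 := by
  have hbot : ∀ᶠ k in Filter.atBot, coeffMatrix ((zSub A)⁻¹ * const B) k = 0 := by
    have h1 : ∀ a b, ∀ᶠ k in Filter.atBot,
        coeffMatrix ((zSub A)⁻¹ * const B) k a b = 0 := by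
      intro a b
      filter_upwards [Filter.eventually_lt_atBot
        (expansion (((zSub A)⁻¹ * const B) a b)).order] with k hk
      rw [coeffMatrix, Matrix.map_apply, kernelScalar_eq_coeff]
      exact HahnSeries.coeff_eq_zero_of_lt_order hk
    filter_upwards [Filter.eventually_all.2 fun a => Filter.eventually_all.2 (h1 a)] with k hk
    ext a b
    exact hk a b
  obtain ⟨K, hK, hKk⟩ := (hbot.and (Filter.eventually_le_atBot k)).exists
  induction k, hKk using Int.leInduction with
  | base => exact hK
  | succ j hj ih =>
    rw [coeffMatrix_resolvent_add_one, ih (by omega), if_neg (by omega), Matrix.mul_zero, add_zero]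

theorem coeffMatrix_resolvent_succ [Finite q] (A : Matrix s s ℝ) (B : Matrix s q ℝ) (t : ℕ) :
    coeffMatrix ((zSub A)⁻¹ * const B) ((t : ℤ) + 1) = A ^ t * B := by
  rw [coeffMatrix_resolvent_add_one]
  induction t with
  | zero =>
    rw [Nat.cast_zero, coeffMatrix_resolvent_of_nonpos A B le_rfl, if_pos rfl]
    simp
  | succ t ih =>
    rw [Nat.cast_succ, coeffMatrix_resolvent_add_one, ih, if_neg (by omega), add_zero, pow_succ',
      Matrix.mul_assoc]

theorem coeffMatrix_ssreal_of_nonpos [Finite q] (A : Matrix s s ℝ) (B : Matrix s q ℝ)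
    (C : Matrix p s ℝ) {k : ℤ} (hk : k ≤ 0) : coeffMatrix (ssreal A B C 0) k = 0 := by
  rw [ssreal, const_zero, add_zero, Matrix.mul_assoc, coeffMatrix_const_mul,
    coeffMatrix_resolvent_of_nonpos A B hk, Matrix.mul_zero]

theorem kernel_ssreal_succ [Finite q] (A : Matrix s s ℝ) (B : Matrix s q ℝ)
    (C : Matrix p s ℝ) (t : ℕ) : kernel (ssreal A B C 0) (t + 1) = C * (A ^ t * B) := by
  rw [kernel_eq_coeffMatrix, ssreal, const_zero, add_zero, Matrix.mul_assoc,
    coeffMatrix_const_mul, Nat.cast_succ, coeffMatrix_resolvent_succ]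

theorem const_eq_map (M : Matrix p q ℝ) :
    const M = (M.map Polynomial.C).map (algebraMap (Polynomial ℝ) (RatFunc ℝ)) := by
  ext a b : 2
  simp [const]

/-- The entries of a realization are polynomials divided by the characteristic polynomial. -/
theorem ssreal_apply_eq_div (A : Matrix s s ℝ) (B : Matrix s q ℝ) (C : Matrix p s ℝ)
    (a : p) (b : q) : ∃ P : Polynomial ℝ, ssreal A B C 0 a b =
      algebraMap (Polynomial ℝ) (RatFunc ℝ) P /
        algebraMap (Polynomial ℝ) (RatFunc ℝ) A.charpoly := by
  refine ⟨((C.map Polynomial.C) * (charmatrix A).adjugate * (B.map Polynomial.C)) a b, ?_⟩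
  have hadj : (zSub A).adjugate =
      (charmatrix A).adjugate.map (algebraMap (Polynomial ℝ) (RatFunc ℝ)) := by
    rw [zSub_eq_map_charmatrix]
    exact (RingHom.map_adjugate _ _).symm
  rw [ssreal, const_zero, add_zero, Matrix.inv_def, det_zSub, hadj, const_eq_map C, const_eq_map B,
    Matrix.mul_smul, Matrix.smul_mul, Ring.inverse_eq_inv', ← Matrix.map_mul, ← Matrix.map_mul,
    Matrix.smul_apply, Matrix.map_apply, smul_eq_mul, mul_comm, div_eq_mul_inv]

/-- A strictly proper realization whose state matrix is stable lies in `(1/z) RH∞`. -/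
theorem isInvZRHInf_ssreal [Finite q] (A : Matrix s s ℝ) (B : Matrix s q ℝ) (C : Matrix p s ℝ)
    (hA : ∀ z : ℂ, Polynomial.aeval z A.charpoly = 0 → ‖z‖ < 1) :
    IsInvZRHInf (ssreal A B C 0) := by
  intro a b
  rw [Matrix.smul_apply, smul_eq_mul]
  refine ⟨(natDegree_num_le_iff _).2 fun k hk => ?_, fun z hz => hA z ?_⟩
  · rw [kernelScalar_X_mul]
    exact congrFun (congrFun (coeffMatrix_ssreal_of_nonpos A B C (k := k + 1) (by omega)) a) b
  · obtain ⟨P, hP⟩ := ssreal_apply_eq_div A B C a b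
    have hdvd : (RatFunc.X * ssreal A B C 0 a b).denom ∣ A.charpoly := by
      rw [RatFunc.denom_dvd A.charpoly_monic.ne_zero]
      exact ⟨Polynomial.X * P, by rw [hP, map_mul, RatFunc.algebraMap_X, mul_div_assoc]⟩
    obtain ⟨c, hc⟩ := hdvd
    rw [hc, map_mul, hz, zero_mul]

end Realization

end TransferMatrix

namespace SLS

/-! ### The optimal closed loop of one column -/

/-- A complex root of the characteristic polynomial of a real matrix gives an invariant pair of
real vectors: the real and imaginary parts of an eigenvector. -/
theorem exists_invariant_pair {s : Type} [Fintype s] [DecidableEq s] (M : Matrix s s ℝ) {z : ℂ}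
    (hz : Polynomial.aeval z M.charpoly = 0) :
    ∃ a b : s → ℝ, ¬(a = 0 ∧ b = 0) ∧ M *ᵥ a = z.re • a - z.im • b ∧
      M *ᵥ b = z.im • a + z.re • b := by
  have hdet : (Matrix.scalar s z - M.map (algebraMap ℝ ℂ)).det = 0 := by
    rw [← eval_charpoly]
    have h := charpoly_map M (algebraMap ℝ ℂ)
    rw [h, Polynomial.eval_map_algebraMap, hz]
  obtain ⟨v, hv, hMv⟩ := exists_mulVec_eq_zero_iff.2 hdet
  rw [sub_mulVec, sub_eq_zero] at hMv
  have hc : ∀ i, ∑ j, (M i j : ℂ) * v j = z * v i := by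
    intro i
    have h := congrFun hMv i
    simp only [scalar_apply, mulVec_diagonal] at h
    rw [h]
    rfl
  refine ⟨fun i => (v i).re, fun i => (v i).im, ?_, ?_, ?_⟩
  · rintro ⟨ha, hb⟩
    exact hv (funext fun i => Complex.ext (congrFun ha i) (congrFun hb i))
  · ext i
    have h := congrArg Complex.re (hc i)
    simpa [mulVec, dotProduct, Complex.mul_re] using h
  · ext i
    have h := congrArg Complex.im (hc i)
    simp only [Complex.im_sum, Complex.mul_im, Complex.ofReal_re, Complex.ofReal_im, zero_mul,
      add_zero] at h
    simp only [mulVec, dotProduct, Pi.add_apply, Pi.smul_apply, smul_eq_mul]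
    rw [h]
    ring

theorem eq_zero_of_rotation {α β s t : ℝ} (h : α ^ 2 + β ^ 2 ≠ 0) (h1 : α * s - β * t = 0)
    (h2 : β * s + α * t = 0) : s = 0 ∧ t = 0 := by
  have hs : (α ^ 2 + β ^ 2) * s = 0 := by linear_combination α * h1 + β * h2
  have ht : (α ^ 2 + β ^ 2) * t = 0 := by linear_combination α * h2 - β * h1
  exact ⟨(mul_eq_zero.1 hs).resolve_left h, (mul_eq_zero.1 ht).resolve_left h⟩

section Column

variable {n m : ℕ} {A : Matrix (Fin n) (Fin n) ℝ} {B : Matrix (Fin n) (Fin m) ℝ}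
  {Q : Matrix (Fin n) (Fin n) ℝ} {R : Matrix (Fin m) (Fin m) ℝ}
  {sx : ℕ → Fin n → Bool} {su : ℕ → Fin m → Bool} {d : ℕ}
  (N : ∀ k, NullBasis (elimF B (su k) (sx (k + 1))))
  (Nstar : NullBasis (elimF B (su d) (sx d)))
  (Xstar : Matrix {a // sx d a = true} {a // sx d a = true} ℝ)

variable (A Q R) in
/-- The optimal feedback at time `t + 1`. -/
noncomputable def columnPolicy (t : ℕ) : Matrix (Fin m) (Fin n) ℝ :=
  if t < d then Kcl A B Q R sx su d N Xstar (t + 1) else KclStar A B Q R sx su d Nstar Xstar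

theorem Xtil_of_lt {k : ℕ} (hk : d < k) :
    Xtil A B Q R sx su d N Xstar k = terminalX sx d Xstar := by
  rw [Xtil, show d + 1 - k = 0 by omega, backwardX]

theorem Xtil_eq_riccati {k : ℕ} (hk : 1 ≤ k) (hkd : k ≤ d) :
    Xtil A B Q R sx su d N Xstar k = (reducedData A B Q R (su k) (sx (k + 1)) (N k)).riccati
      (Xtil A B Q R sx su d N Xstar (k + 1)) := by
  obtain ⟨j, hj, rfl⟩ : ∃ j, j < d ∧ k = d - j := ⟨d - k, by omega, by omega⟩
  rw [Xtil, Xtil, show d + 1 - (d - j) = j + 1 by omega, show d + 1 - (d - j + 1) = j by omega,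
    backwardX]

theorem posSemidef_backwardX (hQ : Q.PosDef) (hR : R.PosDef) (hX : Xstar.PosSemidef) (j : ℕ) :
    (backwardX A B Q R sx su d N Xstar j).PosSemidef := by
  induction j with
  | zero => exact posSemidef_zeroExtend hX
  | succ j ih => exact posSemidef_reducedData_riccati _ hQ hR ih

theorem Acl_mulVec (k : ℕ) (x : Fin n → ℝ) : Acl A B Q R sx su d N Xstar k *ᵥ x =
    A *ᵥ x + B *ᵥ (Kcl A B Q R sx su d N Xstar k *ᵥ x) :=
  closedLoop_mulVec (N k) _ x

theorem supportedIn_AclStar_mulVec (x : Fin n → ℝ) :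
    SupportedIn (sx d) (AclStar A B Q R sx su d Nstar Xstar *ᵥ x) := by
  rw [AclStar, ← mulVec_mulVec, ← mulVec_mulVec]
  exact supportedIn_onSupport_mulVec _ _

variable {Nstar Xstar}

theorem AclStar_mulVec (hR : R.PosDef)
    (hcont : ∀ x, SupportedIn (sx d) x → ∃ u, SupportedIn (su d) u ∧
      SupportedIn (sx d) (A *ᵥ x + B *ᵥ u))
    (hX : IsStationarySolution A B Q R (su d) (sx d) Nstar Xstar)
    {x : Fin n → ℝ} (hx : SupportedIn (sx d) x) :
    AclStar A B Q R sx su d Nstar Xstar *ᵥ x =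
      A *ᵥ x + B *ᵥ (KclStar A B Q R sx su d Nstar Xstar *ᵥ x) := by
  have hsupp := (bellmanStep_stationary Nstar hR hcont hX).supp_x x hx
  change _ = A *ᵥ x + B *ᵥ (staticPolicy A Q R Nstar Xstar *ᵥ x)
  rw [staticPolicy_mulVec _ _ hx, ← closedLoop_mulVec] at hsupp ⊢
  rw [AclStar, staticData, LQData.closedLoop_restrict, ← mulVec_mulVec, ← mulVec_mulVec,
    ← mulVec_mulVec, ← mulVec_mulVec, onSupport_mulVec_transpose_mulVec hx,
    onSupport_mulVec_transpose_mulVec hsupp]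

/-- The backward recursion followed by the stationary solution solves the Bellman equations of the
column. -/
theorem isBellman_column (hQ : Q.PosDef) (hR : R.PosDef)
    (hsx : ∀ k, d ≤ k → sx k = sx d) (hsu : ∀ k, d ≤ k → su k = su d) (hd : 1 ≤ d)
    (hcont : ∀ k, 1 ≤ k → ∀ x, SupportedIn (sx k) x → ∃ u, SupportedIn (su k) u ∧
      SupportedIn (sx (k + 1)) (A *ᵥ x + B *ᵥ u))
    (hX : IsStationarySolution A B Q R (su d) (sx d) Nstar Xstar) :
    IsBellman A B Q R (fun t => sx (t + 1)) (fun t => su (t + 1))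
      (fun t => Xtil A B Q R sx su d N Xstar (t + 1))
      (columnPolicy A Q R N Nstar Xstar) where
  posSemidef t := posSemidef_backwardX N Xstar hQ hR hX.1.posSemidef _
  eventually_const := by
    refine ⟨terminalX sx d Xstar, ?_⟩
    filter_upwards [Filter.eventually_ge_atTop d] with t ht
    exact Xtil_of_lt N Xstar (by omega)
  step t := by
    by_cases ht : t < d
    · rw [columnPolicy, if_pos ht, Xtil_eq_riccati N Xstar (by omega) (by omega : t + 1 ≤ d)]
      exact bellmanStep_reducedData hR (N (t + 1)) (hcont (t + 1) (by omega))
        (posSemidef_backwardX N Xstar hQ hR hX.1.posSemidef _)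
    · have hc := hcont d hd
      rw [hsx (d + 1) (by omega)] at hc
      rw [columnPolicy, if_neg ht, Xtil_of_lt N Xstar (by omega), Xtil_of_lt N Xstar (by omega),
        hsx (t + 1) (by omega), hsx (t + 1 + 1) (by omega), hsu (t + 1) (by omega)]
      exact bellmanStep_stationary Nstar hR hc hX

/-- The stationary closed loop is stable in the Lyapunov sense, with `Q` as the decay. -/
theorem quadForm_AclStar_mulVec_le (hR : R.PosDef)
    (hcont : ∀ x, SupportedIn (sx d) x → ∃ u, SupportedIn (su d) u ∧
      SupportedIn (sx d) (A *ᵥ x + B *ᵥ u))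
    (hX : IsStationarySolution A B Q R (su d) (sx d) Nstar Xstar)
    {x : Fin n → ℝ} (hx : SupportedIn (sx d) x) :
    quadForm (terminalX sx d Xstar) (AclStar A B Q R sx su d Nstar Xstar *ᵥ x) + quadForm Q x ≤
      quadForm (terminalX sx d Xstar) x := by
  have h := (bellmanStep_stationary Nstar hR hcont hX).eq x hx
  rw [AclStar_mulVec hR hcont hX hx]
  have h1 := quadForm_nonneg hR.posSemidef (staticPolicy A Q R Nstar Xstar *ᵥ x)
  change _ = _ + quadForm (terminalX sx d Xstar)
    (A *ᵥ x + B *ᵥ (KclStar A B Q R sx su d Nstar Xstar *ᵥ x)) at h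
  change quadForm (terminalX sx d Xstar) x = _ at h
  linarith

theorem ASF_mulVec (v : Fin (d + 1) × Fin n → ℝ) (p : Fin (d + 1)) (a : Fin n) :
    (ASF A B Q R sx su d N Nstar Xstar *ᵥ v) (p, a) =
      (∑ q : Fin (d + 1), if (p : ℕ) = (q : ℕ) + 1 then
        (Acl A B Q R sx su d N Xstar ((q : ℕ) + 1) *ᵥ fun b => v (q, b)) a else 0) +
      if (p : ℕ) = d then
        (AclStar A B Q R sx su d Nstar Xstar *ᵥ fun b => v (Fin.last d, b)) a else 0 := by
  have hlast : (if (p : ℕ) = d then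
      (AclStar A B Q R sx su d Nstar Xstar *ᵥ fun b => v (Fin.last d, b)) a else 0) =
      ∑ q : Fin (d + 1), if q = Fin.last d then (if (p : ℕ) = d then
        (AclStar A B Q R sx su d Nstar Xstar *ᵥ fun b => v (q, b)) a else 0) else 0 := by
    simp
  rw [hlast, ← Finset.sum_add_distrib, mulVec, dotProduct, Fintype.sum_prod_type]
  refine Finset.sum_congr rfl fun q _ => ?_
  by_cases h1 : (p : ℕ) = (q : ℕ) + 1
  · have h2 : q ≠ Fin.last d := by
      rintro rfl
      have := p.2
      simp only [Fin.val_last] at h1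
      omega
    simp [ASF, h1, h2, mulVec, dotProduct]
  · by_cases h2 : q = Fin.last d
    · subst h2
      by_cases h3 : (p : ℕ) = d
      · simp [ASF, h3, mulVec, dotProduct]
      · simp [ASF, h3, mulVec, dotProduct]
    · have h3 : (q : ℕ) ≠ d := fun h => h2 (Fin.ext h)
      simp [ASF, h1, h2, h3]

/-- All eigenvalues of `A_SF` lie in the open unit disc: the subdiagonal blocks are nilpotent, so a
nonzero eigenvalue belongs to the stationary block. -/
theorem norm_lt_one_of_charpoly_ASF (hd : 1 ≤ d) (hQ : Q.PosDef) (hR : R.PosDef)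
    (hcont : ∀ x, SupportedIn (sx d) x → ∃ u, SupportedIn (su d) u ∧
      SupportedIn (sx d) (A *ᵥ x + B *ᵥ u))
    (hX : IsStationarySolution A B Q R (su d) (sx d) Nstar Xstar) (z : ℂ)
    (hz : Polynomial.aeval z (ASF A B Q R sx su d N Nstar Xstar).charpoly = 0) : ‖z‖ < 1 := by
  by_cases hz0 : z = 0
  · simp [hz0]
  have hαβ : z.re ^ 2 + z.im ^ 2 ≠ 0 := by
    have h := Complex.normSq_pos.2 hz0
    rw [Complex.normSq_apply] at h
    nlinarith
  obtain ⟨a, b, hab, ha, hb⟩ := exists_invariant_pair _ hz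
  have hA : ∀ p i, (ASF A B Q R sx su d N Nstar Xstar *ᵥ a) (p, i) =
      z.re * a (p, i) - z.im * b (p, i) := fun p i => congrFun ha (p, i)
  have hB : ∀ p i, (ASF A B Q R sx su d N Nstar Xstar *ᵥ b) (p, i) =
      z.im * a (p, i) + z.re * b (p, i) := fun p i => congrFun hb (p, i)
  -- The blocks before the last one vanish, one after the other.
  have hblock : ∀ k (hk : k < d), ∀ i, a (⟨k, by omega⟩, i) = 0 ∧ b (⟨k, by omega⟩, i) = 0 := by
    intro k
    induction k with
    | zero =>
      intro hk i
      have h1 := hA ⟨0, by omega⟩ i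
      have h2 := hB ⟨0, by omega⟩ i
      rw [ASF_mulVec, if_neg (by simp; omega)] at h1 h2
      simp only [add_zero] at h1 h2
      rw [Finset.sum_eq_zero fun q _ => if_neg (by simp)] at h1 h2
      exact eq_zero_of_rotation hαβ h1.symm h2.symm
    | succ k ih =>
      intro hk i
      have h1 := hA ⟨k + 1, by omega⟩ i
      have h2 := hB ⟨k + 1, by omega⟩ i
      rw [ASF_mulVec, if_neg (by simp; omega), add_zero] at h1 h2
      have hz : ∀ q : Fin (d + 1), k + 1 = (q : ℕ) + 1 →
          (fun i => a (q, i)) = 0 ∧ (fun i => b (q, i)) = 0 := by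
        intro q hq
        have hqk : q = ⟨k, by omega⟩ := Fin.ext (by simp only; omega)
        rw [hqk]
        exact ⟨funext fun i => (ih (by omega) i).1, funext fun i => (ih (by omega) i).2⟩
      rw [Finset.sum_eq_zero] at h1 h2
      · exact eq_zero_of_rotation hαβ h1.symm h2.symm
      all_goals
        intro q _
        split_ifs with hq
        · simp [hz q hq]
        · rfl
  have hsum : ∀ v : Fin (d + 1) × Fin n → ℝ, (∀ k (hk : k < d), ∀ i, v (⟨k, by omega⟩, i) = 0) →
      ∀ i, (ASF A B Q R sx su d N Nstar Xstar *ᵥ v) (Fin.last d, i) =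
        (AclStar A B Q R sx su d Nstar Xstar *ᵥ fun b => v (Fin.last d, b)) i := by
    intro v hv i
    rw [ASF_mulVec, if_pos (by simp), Finset.sum_eq_zero, zero_add]
    intro q _
    split_ifs with hq
    · have : (fun i => v (q, i)) = 0 := funext fun i => hv q (by simp at hq; omega) i
      simp [this]
    · rfl
  set α := z.re
  set β := z.im
  let f : Fin n → ℝ := fun i => a (Fin.last d, i)
  let g : Fin n → ℝ := fun i => b (Fin.last d, i)
  have hf : AclStar A B Q R sx su d Nstar Xstar *ᵥ f = α • f - β • g := by
    ext i
    rw [← hsum a (fun k hk i => (hblock k hk i).1) i]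
    exact hA _ i
  have hg : AclStar A B Q R sx su d Nstar Xstar *ᵥ g = β • f + α • g := by
    ext i
    rw [← hsum b (fun k hk i => (hblock k hk i).2) i]
    exact hB _ i
  have hfg : ¬(f = 0 ∧ g = 0) := by
    rintro ⟨hf0, hg0⟩
    refine hab ⟨?_, ?_⟩ <;> ext ⟨p, i⟩ <;>
      rcases (Nat.lt_succ_iff.1 p.2).lt_or_eq with hp | hp
    · exact (hblock p hp i).1
    · obtain rfl : p = Fin.last d := Fin.ext hp
      exact congrFun hf0 i
    · exact (hblock p hp i).2
    · obtain rfl : p = Fin.last d := Fin.ext hp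
      exact congrFun hg0 i
  have hs : ∀ i, sx d i = false → f i = 0 ∧ g i = 0 := by
    intro i hi
    have h1 := supportedIn_AclStar_mulVec (A := A) (B := B) (Q := Q) (R := R) Nstar Xstar f i hi
    have h2 := supportedIn_AclStar_mulVec (A := A) (B := B) (Q := Q) (R := R) Nstar Xstar g i hi
    rw [hf] at h1
    rw [hg] at h2
    exact eq_zero_of_rotation hαβ h1 h2
  have hLf := quadForm_AclStar_mulVec_le hR hcont hX (x := f) fun i hi => (hs i hi).1
  have hLg := quadForm_AclStar_mulVec_le hR hcont hX (x := g) fun i hi => (hs i hi).2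
  have hrot : quadForm (terminalX sx d Xstar) (α • f - β • g) +
      quadForm (terminalX sx d Xstar) (β • f + α • g) =
      (α ^ 2 + β ^ 2) * (quadForm (terminalX sx d Xstar) f +
        quadForm (terminalX sx d Xstar) g) := by
    simp only [quadForm, mulVec_sub, mulVec_add, mulVec_smul, sub_dotProduct, add_dotProduct,
      dotProduct_sub, dotProduct_add, smul_dotProduct, dotProduct_smul, smul_eq_mul]
    ring
  rw [hf] at hLf
  rw [hg] at hLg
  have hQpos : 0 < quadForm Q f + quadForm Q g := by
    have h1 := quadForm_nonneg hQ.posSemidef f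
    have h2 := quadForm_nonneg hQ.posSemidef g
    by_cases hf0 : f = 0
    · have := quadForm_pos hQ fun hg0 : g = 0 => hfg ⟨hf0, hg0⟩
      linarith
    · have := quadForm_pos hQ hf0
      linarith
  have hVf := quadForm_nonneg (posSemidef_zeroExtend hX.1.posSemidef) f
  have hVg := quadForm_nonneg (posSemidef_zeroExtend hX.1.posSemidef) g
  change 0 ≤ quadForm (terminalX sx d Xstar) f at hVf
  change 0 ≤ quadForm (terminalX sx d Xstar) g at hVg
  have hlt : α ^ 2 + β ^ 2 < 1 := by
    by_contra hge
    nlinarith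
  have hn : ‖z‖ ^ 2 = α ^ 2 + β ^ 2 := by
    rw [← Complex.normSq_eq_norm_sq, Complex.normSq_apply]
    simp only [α, β]
    ring
  rw [← hn] at hlt
  exact (sq_lt_one_iff₀ (norm_nonneg z)).1 hlt

/-- The state of the realization at time `t + 1`: only block `min t d` is occupied, by the state of
the closed-loop trajectory. -/
noncomputable def blockState (d : ℕ) (x : ℕ → Fin n → ℝ) (t : ℕ) : Fin (d + 1) × Fin n → ℝ :=
  fun pa => if (pa.1 : ℕ) = min t d then x t pa.2 else 0

theorem ASF_mulVec_blockState {x : ℕ → Fin n → ℝ} {t : ℕ}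
    (hlt : t < d → x (t + 1) = Acl A B Q R sx su d N Xstar (t + 1) *ᵥ x t)
    (hge : d ≤ t → x (t + 1) = AclStar A B Q R sx su d Nstar Xstar *ᵥ x t) :
    ASF A B Q R sx su d N Nstar Xstar *ᵥ blockState d x t = blockState d x (t + 1) := by
  have hb : ∀ q : Fin (d + 1), (fun b => blockState d x t (q, b)) =
      if (q : ℕ) = min t d then x t else 0 := by
    intro q
    ext b
    simp only [blockState]
    split_ifs <;> rfl
  ext ⟨p, a⟩
  rw [ASF_mulVec]
  simp only [hb]
  rcases lt_or_ge t d with ht | ht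
  · rw [show (if ((Fin.last d : Fin (d + 1)) : ℕ) = min t d then x t else 0) = 0 from
      if_neg (by simp; omega)]
    rw [Finset.sum_eq_single (⟨t, by omega⟩ : Fin (d + 1))]
    · simp only [blockState, min_eq_left ht.le, min_eq_left (Nat.succ_le_of_lt ht), if_true,
        mulVec_zero, Pi.zero_apply, ite_self, add_zero, hlt ht]
    · intro q _ hq
      have : ¬(q : ℕ) = min t d := fun h => hq (Fin.ext (by simp only; omega))
      simp [this]
    · simp
  · rw [Finset.sum_eq_zero]
    · simp only [blockState, Fin.val_last, min_eq_right ht, min_eq_right (Nat.le_succ_of_le ht),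
        if_true, zero_add, hge ht]
    · intro q _
      split_ifs with h1 h2
      · have := p.2
        omega
      · simp
      · rfl

theorem ASF_pow_mul_BSF {x : ℕ → Fin n → ℝ} {i : Fin n} (h0 : x 0 = Pi.single i 1)
    (hlt : ∀ t, t < d → x (t + 1) = Acl A B Q R sx su d N Xstar (t + 1) *ᵥ x t)
    (hge : ∀ t, d ≤ t → x (t + 1) = AclStar A B Q R sx su d Nstar Xstar *ᵥ x t) (t : ℕ) :
    ASF A B Q R sx su d N Nstar Xstar ^ t * BSF n d i =
      Matrix.of fun pa _ => blockState d x t pa := by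
  induction t with
  | zero =>
    rw [pow_zero, Matrix.one_mul]
    ext ⟨p, a⟩ c
    simp only [BSF, of_apply, blockState, h0, Pi.single_apply, Nat.zero_min, Fin.val_eq_zero_iff,
      ite_and]
  | succ t ih =>
    rw [pow_succ', Matrix.mul_assoc, ih]
    ext pa c
    rw [of_apply, ← ASF_mulVec_blockState (Nstar := Nstar) N (hlt t) (hge t)]
    rfl

theorem CSF_mul_blockState (x : ℕ → Fin n → ℝ) (t : ℕ) (a : Fin n) (c : Unit) :
    (CSF n d * Matrix.of fun pa (_ : Unit) => blockState d x t pa) a c = x t a := by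
  rw [Matrix.mul_apply, Fintype.sum_prod_type,
    Finset.sum_eq_single (⟨min t d, by omega⟩ : Fin (d + 1))]
  · simp [CSF, blockState, Matrix.one_apply]
  · intro q _ hq
    have : ¬(q : ℕ) = min t d := fun h => hq (Fin.ext h)
    simp [blockState, this]
  · simp

theorem KSF_mul_blockState (x : ℕ → Fin n → ℝ) (t : ℕ) (a : Fin m) (c : Unit) :
    (KSF A B Q R sx su d N Nstar Xstar * Matrix.of fun pa (_ : Unit) => blockState d x t pa) a c =
      (columnPolicy A Q R N Nstar Xstar t *ᵥ x t) a := by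
  rw [Matrix.mul_apply, Fintype.sum_prod_type,
    Finset.sum_eq_single (⟨min t d, by omega⟩ : Fin (d + 1))]
  · rcases lt_or_ge t d with ht | ht
    · simp [KSF, blockState, columnPolicy, ht, min_eq_left ht.le, mulVec, dotProduct]
    · simp [KSF, blockState, columnPolicy, ht.not_gt, min_eq_right ht, mulVec, dotProduct]
  · intro q _ hq
    have : ¬(q : ℕ) = min t d := fun h => hq (Fin.ext h)
    simp [blockState, this]
  · simp

end Column

open TransferMatrix

/-! ### Decomposition of the problem into columns -/

variable {n m : ℕ} {A : Matrix (Fin n) (Fin n) ℝ} {B : Matrix (Fin n) (Fin m) ℝ}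
  {Q : Matrix (Fin n) (Fin n) ℝ} {R : Matrix (Fin m) (Fin m) ℝ}

/-- The column `i` of the kernel at step `t + 1`. -/
noncomputable def kernelColumn {p q : Type} (Φ : TransferMatrix p q) (i : q) (t : ℕ) : p → ℝ :=
  fun a => kernel Φ (t + 1) a i

/-- The infinite-horizon cost of a trajectory; on the kernel columns, the contribution of a column
to the square of the objective. -/
noncomputable def columnCost (Q : Matrix (Fin n) (Fin n) ℝ) (R : Matrix (Fin m) (Fin m) ℝ)
    (x : ℕ → Fin n → ℝ) (u : ℕ → Fin m → ℝ) : ℝ≥0∞ :=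
  ∑' t, ENNReal.ofReal (quadForm Q (x t) + quadForm R (u t))

theorem cost_eq_sum_columnCost (hQ : Q.PosSemidef) (hR : R.PosSemidef)
    {Φx : TransferMatrix (Fin n) (Fin n)} {Φu : TransferMatrix (Fin m) (Fin n)}
    (hx : IsInvZRHInf Φx) (hu : IsInvZRHInf Φu) :
    cost Q R Φx Φu =
      (∑ i, columnCost Q R (kernelColumn Φx i) (kernelColumn Φu i)) ^ (1 / 2 : ℝ) := by
  have hterm : ∀ k : ℕ, ∑ a, ∑ b, kernel (Matrix.fromRows (const (CFC.sqrt Q) * Φx)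
      (const (CFC.sqrt R) * Φu)) k a b ^ 2 =
      ∑ i, (quadForm Q (fun a => kernel Φx k a i) + quadForm R (fun a => kernel Φu k a i)) := by
    intro k
    have hl : ∀ a i, kernel (Matrix.fromRows (const (CFC.sqrt Q) * Φx)
        (const (CFC.sqrt R) * Φu)) k (Sum.inl a) i =
        (CFC.sqrt Q *ᵥ fun a => kernel Φx k a i) a := fun a i =>
      congrFun (congrFun (coeffMatrix_const_mul (CFC.sqrt Q) Φx k) a) i
    have hr : ∀ a i, kernel (Matrix.fromRows (const (CFC.sqrt Q) * Φx)
        (const (CFC.sqrt R) * Φu)) k (Sum.inr a) i =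
        (CFC.sqrt R *ᵥ fun a => kernel Φu k a i) a := fun a i =>
      congrFun (congrFun (coeffMatrix_const_mul (CFC.sqrt R) Φu k) a) i
    rw [Finset.sum_comm]
    refine Finset.sum_congr rfl fun i _ => ?_
    rw [Fintype.sum_sum_type]
    simp only [hl, hr, sum_sq_sqrt_mulVec hQ, sum_sq_sqrt_mulVec hR]
  have hzero : ∑ i, (quadForm Q (fun a => kernel Φx 0 a i) +
      quadForm R (fun a => kernel Φu 0 a i)) = 0 := by
    have h1 : kernel Φx 0 = 0 := hx.coeffMatrix_eq_zero le_rfl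
    have h2 : kernel Φu 0 = 0 := hu.coeffMatrix_eq_zero le_rfl
    simp [h1, h2, quadForm, dotProduct]
  rw [cost, h2norm]
  congr 1
  simp only [hterm]
  rw [tsum_eq_zero_add' ENNReal.summable, hzero, ENNReal.ofReal_zero, zero_add]
  simp only [columnCost]
  rw [← Summable.tsum_finsetSum fun i _ => ENNReal.summable]
  refine tsum_congr fun t => ?_
  rw [ENNReal.ofReal_sum_of_nonneg fun i _ => add_nonneg (quadForm_nonneg hQ _)
    (quadForm_nonneg hR _)]
  rfl

variable {Sx : SparsityPattern (Fin n) (Fin n)} {Su : SparsityPattern (Fin m) (Fin n)}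
  {Φx : TransferMatrix (Fin n) (Fin n)} {Φu : TransferMatrix (Fin m) (Fin n)}

/-- The achievability constraint at the coefficient of `z⁻ᵏ`. -/
theorem coeffMatrix_achievable (k : ℤ) :
    coeffMatrix (zSub A * Φx - const B * Φu) k =
      coeffMatrix Φx (k + 1) - A * coeffMatrix Φx k - B * coeffMatrix Φu k := by
  rw [coeffMatrix_sub, coeffMatrix_zSub_mul, coeffMatrix_const_mul]

theorem coeffMatrix_one (k : ℤ) :
    coeffMatrix (1 : TransferMatrix (Fin n) (Fin n)) k = if k = 0 then 1 else 0 := by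
  rw [← const_one, coeffMatrix_const]

/-- The feasible closed-loop maps are the pairs of maps in `(1/z) RH∞` whose kernel columns are
trajectories in the column patterns that start at the standard basis vectors. -/
theorem isFeasible_iff : IsFeasible A B Sx Su Φx Φu ↔ IsInvZRHInf Φx ∧ IsInvZRHInf Φu ∧
    ∀ i, kernelColumn Φx i 0 = Pi.single i 1 ∧
      IsTrajectory A B (fun t => Sx.column i (t + 1)) (fun t => Su.column i (t + 1))
        (kernelColumn Φx i) (kernelColumn Φu i) := by
  constructor
  · intro h
    refine ⟨h.stable_x, h.stable_u, fun i => ⟨?_, ?_, ?_, ?_⟩⟩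
    · have h1 := coeffMatrix_achievable (A := A) (B := B) (Φx := Φx) (Φu := Φu) 0
      rw [h.achievable, coeffMatrix_one, h.stable_x.coeffMatrix_eq_zero le_rfl,
        h.stable_u.coeffMatrix_eq_zero le_rfl, if_pos rfl, Matrix.mul_zero, Matrix.mul_zero,
        sub_zero, sub_zero] at h1
      ext a
      have h2 := congrFun (congrFun h1 a) i
      rw [Matrix.one_apply] at h2
      rw [Pi.single_apply]
      exact h2.symm
    · intro t
      have h1 := coeffMatrix_achievable (A := A) (B := B) (Φx := Φx) (Φu := Φu) ((t + 1 : ℕ) : ℤ)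
      rw [h.achievable, coeffMatrix_one, if_neg (by omega), sub_sub, eq_comm, sub_eq_zero] at h1
      ext a
      exact congrFun (congrFun h1 a) i
    · exact fun t => h.sparse_x (t + 1) (by omega) i
    · exact fun t => h.sparse_u (t + 1) (by omega) i
  · rintro ⟨hx, hu, h⟩
    refine ⟨coeffMatrix_ext fun k => ?_, hx, hu, ?_, ?_⟩
    · rw [coeffMatrix_achievable, coeffMatrix_one]
      rcases lt_trichotomy k 0 with hk | rfl | hk
      · rw [hx.coeffMatrix_eq_zero (by omega), hx.coeffMatrix_eq_zero hk.le,
          hu.coeffMatrix_eq_zero hk.le, if_neg hk.ne]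
        simp
      · rw [hx.coeffMatrix_eq_zero le_rfl, hu.coeffMatrix_eq_zero le_rfl, if_pos rfl,
          Matrix.mul_zero, Matrix.mul_zero, sub_zero, sub_zero]
        ext a i
        have h1 := congrFun (h i).1 a
        rw [Pi.single_apply] at h1
        rw [Matrix.one_apply]
        exact h1
      · obtain ⟨t, rfl⟩ : ∃ t : ℕ, k = ((t + 1 : ℕ) : ℤ) := ⟨(k - 1).toNat, by omega⟩
        rw [if_neg hk.ne', sub_sub, sub_eq_zero]
        ext a i
        exact congrFun ((h i).2.step t) a
    · intro k hk i
      obtain ⟨t, rfl⟩ : ∃ t : ℕ, k = t + 1 := ⟨k - 1, by omega⟩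
      exact (h i).2.supp_x t
    · intro k hk i
      obtain ⟨t, rfl⟩ : ∃ t : ℕ, k = t + 1 := ⟨k - 1, by omega⟩
      exact (h i).2.supp_u t

section ColumnBounds

variable {sx : ℕ → Fin n → Bool} {su : ℕ → Fin m → Bool}
  {V : ℕ → Matrix (Fin n) (Fin n) ℝ} {G : ℕ → Matrix (Fin m) (Fin n) ℝ}
  {x : ℕ → Fin n → ℝ} {u : ℕ → Fin m → ℝ}

theorem summable_of_columnCost_ne_top (hQ : Q.PosDef) (hR : R.PosDef)
    (h : columnCost Q R x u ≠ ∞) :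
    (Summable fun t => quadForm Q (x t) + quadForm R (u t)) ∧
      columnCost Q R x u = ENNReal.ofReal (∑' t, (quadForm Q (x t) + quadForm R (u t))) := by
  have h0 : ∀ t, 0 ≤ quadForm Q (x t) + quadForm R (u t) := fun t =>
    add_nonneg (quadForm_nonneg hQ.posSemidef _) (quadForm_nonneg hR.posSemidef _)
  have hs : Summable fun t => quadForm Q (x t) + quadForm R (u t) := by
    have := ENNReal.summable_toReal h
    simpa only [ENNReal.toReal_ofReal (h0 _)] using this
  exact ⟨hs, (ENNReal.ofReal_tsum_of_nonneg h0 hs).symm⟩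

theorem IsBellman.ofReal_le_columnCost (h : IsBellman A B Q R sx su V G) (hQ : Q.PosDef)
    (hR : R.PosDef) (hx : IsTrajectory A B sx su x u) :
    ENNReal.ofReal (quadForm (V 0) (x 0)) ≤ columnCost Q R x u := by
  by_cases hc : columnCost Q R x u = ∞
  · rw [hc]
    exact le_top
  obtain ⟨hs, he⟩ := summable_of_columnCost_ne_top hQ hR hc
  rw [he]
  exact ENNReal.ofReal_le_ofReal (h.quadForm_le_tsum hQ hR hx hs)

theorem IsBellman.columnCost_feedback_le (h : IsBellman A B Q R sx su V G) (hQ : Q.PosDef)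
    (hR : R.PosDef) {ξ : Fin n → ℝ} (hξ : SupportedIn (sx 0) ξ) :
    columnCost Q R (feedbackState A B G ξ) (fun t => G t *ᵥ feedbackState A B G ξ t) ≤
      ENNReal.ofReal (quadForm (V 0) ξ) := by
  obtain ⟨hs, hle⟩ := h.summable_feedback hQ hR hξ
  rw [columnCost, ← ENNReal.ofReal_tsum_of_nonneg (fun t =>
    add_nonneg (quadForm_nonneg hQ.posSemidef _) (quadForm_nonneg hR.posSemidef _)) hs]
  exact ENNReal.ofReal_le_ofReal hle

theorem IsBellman.eq_feedback_of_columnCost_le (h : IsBellman A B Q R sx su V G)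
    (hQ : Q.PosDef) (hR : R.PosDef) (hx : IsTrajectory A B sx su x u)
    (hle : columnCost Q R x u ≤ ENNReal.ofReal (quadForm (V 0) (x 0))) (t : ℕ) :
    x t = feedbackState A B G (x 0) t ∧ u t = G t *ᵥ feedbackState A B G (x 0) t := by
  obtain ⟨hs, he⟩ := summable_of_columnCost_ne_top hQ hR (hle.trans_lt ENNReal.ofReal_lt_top).ne
  rw [he, ENNReal.ofReal_le_ofReal_iff (quadForm_nonneg (h.posSemidef 0) _)] at hle
  exact h.eq_feedback hQ hR hx hs hle t

end ColumnBounds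

/-- In a finite sum of extended nonnegative reals, termwise lower bounds with finite values are
attained if the sum does not exceed the sum of the bounds. -/
theorem le_of_sum_le_sum {ι : Type} [Fintype ι] {f g : ι → ℝ≥0∞} (hf : ∀ i, f i ≠ ∞)
    (h : ∀ i, f i ≤ g i) (hs : ∑ i, g i ≤ ∑ i, f i) (i : ι) : g i ≤ f i := by
  classical
  rw [← Finset.add_sum_erase _ g (Finset.mem_univ i),
    ← Finset.add_sum_erase _ f (Finset.mem_univ i)] at hs
  have h1 : g i + ∑ j ∈ Finset.univ.erase i, f j ≤ f i + ∑ j ∈ Finset.univ.erase i, f j :=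
    (add_le_add le_rfl (Finset.sum_le_sum fun j _ => h j)).trans hs
  exact (ENNReal.add_le_add_iff_right (ENNReal.sum_ne_top.2 fun j _ => hf j)).1 h1

theorem supportedIn_single {p : Type} [DecidableEq p] {s : p → Bool} {i : p} (h : s i = true) :
    SupportedIn s (Pi.single i 1) := by
  intro a ha
  rw [Pi.single_apply, if_neg]
  rintro rfl
  rw [h] at ha
  exact Bool.noConfusion ha

/-- If every column has a solution of its Bellman equations, and a pair of maps in `(1/z) RH∞`
has the optimal feedback trajectories as its columns, then this pair is the unique minimizer. -/
theorem isOptimal_iff_eq (hQ : Q.PosDef) (hR : R.PosDef) (hdiag : ∀ i, Sx 1 i i = true)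
    {V : Fin n → ℕ → Matrix (Fin n) (Fin n) ℝ} {G : Fin n → ℕ → Matrix (Fin m) (Fin n) ℝ}
    (hB : ∀ i, IsBellman A B Q R (fun t => Sx.column i (t + 1)) (fun t => Su.column i (t + 1))
      (V i) (G i))
    {Ψx : TransferMatrix (Fin n) (Fin n)} {Ψu : TransferMatrix (Fin m) (Fin n)}
    (hΨx : IsInvZRHInf Ψx) (hΨu : IsInvZRHInf Ψu)
    (hx : ∀ i t, kernelColumn Ψx i t = feedbackState A B (G i) (Pi.single i 1) t)
    (hu : ∀ i t, kernelColumn Ψu i t =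
      G i t *ᵥ feedbackState A B (G i) (Pi.single i 1) t) :
    IsOptimal A B Q R Sx Su Φx Φu ↔ Φx = Ψx ∧ Φu = Ψu := by
  have hx' : ∀ i, kernelColumn Ψx i = feedbackState A B (G i) (Pi.single i 1) :=
    fun i => funext (hx i)
  have hu' : ∀ i, kernelColumn Ψu i = fun t => G i t *ᵥ feedbackState A B (G i) (Pi.single i 1) t :=
    fun i => funext (hu i)
  have hsupp : ∀ i, SupportedIn (Sx.column i (0 + 1)) (Pi.single i 1 : Fin n → ℝ) := fun i =>
    supportedIn_single (hdiag i)
  have hΨ : IsFeasible A B Sx Su Ψx Ψu := by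
    refine isFeasible_iff.2 ⟨hΨx, hΨu, fun i => ?_⟩
    rw [hx', hu']
    exact ⟨rfl, (hB i).isTrajectory_feedback (hsupp i)⟩
  have hlower : ∀ {Ξx Ξu}, IsFeasible A B Sx Su Ξx Ξu → ∀ i,
      ENNReal.ofReal (quadForm (V i 0) (Pi.single i 1)) ≤
        columnCost Q R (kernelColumn Ξx i) (kernelColumn Ξu i) := by
    intro Ξx Ξu hΞ i
    obtain ⟨h0, htr⟩ := (isFeasible_iff.1 hΞ).2.2 i
    rw [← h0]
    exact (hB i).ofReal_le_columnCost hQ hR htr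
  have hΨle : ∀ i, columnCost Q R (kernelColumn Ψx i) (kernelColumn Ψu i) ≤
      ENNReal.ofReal (quadForm (V i 0) (Pi.single i 1)) := by
    intro i
    rw [hx', hu']
    exact (hB i).columnCost_feedback_le hQ hR (hsupp i)
  constructor
  · rintro ⟨hΦ, hopt⟩
    have hle := hopt Ψx Ψu hΨ
    rw [cost_eq_sum_columnCost hQ.posSemidef hR.posSemidef hΦ.stable_x hΦ.stable_u,
      cost_eq_sum_columnCost hQ.posSemidef hR.posSemidef hΨx hΨu,
      ENNReal.rpow_le_rpow_iff (by norm_num)] at hle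
    have hcol := le_of_sum_le_sum (fun _ => ENNReal.ofReal_ne_top) (hlower hΦ)
      (hle.trans (Finset.sum_le_sum fun i _ => hΨle i))
    have heq : ∀ i t, kernelColumn Φx i t = kernelColumn Ψx i t ∧
        kernelColumn Φu i t = kernelColumn Ψu i t := by
      intro i t
      obtain ⟨h0, htr⟩ := (isFeasible_iff.1 hΦ).2.2 i
      have h1 := hcol i
      rw [← h0] at h1
      have h2 := (hB i).eq_feedback_of_columnCost_le hQ hR htr h1 t
      rw [h0] at h2
      rw [hx, hu]
      exact h2
    constructor
    · refine hΦ.stable_x.ext hΨx fun t => ?_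
      ext a i
      exact congrFun (heq i t).1 a
    · refine hΦ.stable_u.ext hΨu fun t => ?_
      ext a i
      exact congrFun (heq i t).2 a
  · rintro ⟨rfl, rfl⟩
    refine ⟨hΨ, fun Ξx Ξu hΞ => ?_⟩
    rw [cost_eq_sum_columnCost hQ.posSemidef hR.posSemidef hΨx hΨu,
      cost_eq_sum_columnCost hQ.posSemidef hR.posSemidef hΞ.stable_x hΞ.stable_u]
    exact ENNReal.rpow_le_rpow (Finset.sum_le_sum fun i _ => (hΨle i).trans (hlower hΞ i))
      (by norm_num)

theorem summable_quadForm {p : Type} [Fintype p] (M : Matrix p p ℝ) {x : ℕ → p → ℝ}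
    (hx : Summable fun t => x t ⬝ᵥ x t) : Summable fun t => quadForm M (x t) := by
  have hle : ∀ t a b, |x t a * x t b| ≤ x t ⬝ᵥ x t := by
    intro t a b
    have h1 : ∀ c, x t c * x t c ≤ x t ⬝ᵥ x t := fun c =>
      Finset.single_le_sum (f := fun c => x t c * x t c) (fun c _ => mul_self_nonneg _)
        (Finset.mem_univ c)
    rw [abs_le]
    constructor <;>
      nlinarith [h1 a, h1 b, sq_nonneg (x t a + x t b), sq_nonneg (x t a - x t b)]
  have h2 : ∀ a b, Summable fun t => x t a * (M a b * x t b) := by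
    intro a b
    have h3 : Summable fun t => x t a * x t b :=
      Summable.of_norm_bounded hx fun t => hle t a b
    exact (h3.mul_left (M a b)).congr fun t => by ring
  simp only [quadForm, dotProduct, mulVec, Finset.mul_sum]
  exact summable_sum fun a _ => summable_sum fun b _ => h2 a b

end SLS

open SLS TransferMatrix in
theorem theorem3 {n m : ℕ} (d : ℕ) (hd : 1 ≤ d)
    (A : Matrix (Fin n) (Fin n) ℝ) (B : Matrix (Fin n) (Fin m) ℝ)
    (Q : Matrix (Fin n) (Fin n) ℝ) (R : Matrix (Fin m) (Fin m) ℝ)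
    (hQ : Q.PosDef) (hR : R.PosDef)
    (Sx : SparsityPattern (Fin n) (Fin n)) (Su : SparsityPattern (Fin m) (Fin n))
    (hSx : Sx.IsDelayed d) (hSu : Su.IsDelayed d)
    (hfeas : ConstraintsFeasible A B Sx Su)
    (N : ∀ (i : Fin n) (k : ℕ), NullBasis (elimF B (Su.column i k) (Sx.column i (k + 1))))
    (Nstar : ∀ i : Fin n, NullBasis (elimF B (Su.column i d) (Sx.column i d))) :
    (∀ i, ∃! X, IsStationarySolution A B Q R (Su.column i d) (Sx.column i d) (Nstar i) X) ∧
    ∀ Xstar : ∀ i : Fin n, Matrix {a // Sx.column i d a = true} {a // Sx.column i d a = true} ℝ,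
      (∀ i, IsStationarySolution A B Q R (Su.column i d) (Sx.column i d) (Nstar i) (Xstar i)) →
      ∀ (Φx : TransferMatrix (Fin n) (Fin n)) (Φu : TransferMatrix (Fin m) (Fin n)),
        IsOptimal A B Q R Sx Su Φx Φu ↔
          ∀ i,
            Φx.submatrix id (fun _ : Unit => i) =
              ssreal (ASF A B Q R (Sx.column i) (Su.column i) d (N i) (Nstar i) (Xstar i))
                (BSF n d i) (CSF n d) 0 ∧
            Φu.submatrix id (fun _ : Unit => i) =
              ssreal (ASF A B Q R (Sx.column i) (Su.column i) d (N i) (Nstar i) (Xstar i))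
                (BSF n d i)
                (KSF A B Q R (Sx.column i) (Su.column i) d (N i) (Nstar i) (Xstar i)) 0 := by
  have hsx : ∀ i k, d ≤ k → Sx.column i k = Sx.column i d := fun i k hk => by
    unfold SparsityPattern.column
    rw [hSx k hk]
  have hsu : ∀ i k, d ≤ k → Su.column i k = Su.column i d := fun i k hk => by
    unfold SparsityPattern.column
    rw [hSu k hk]
  -- One step of an admissible continuation gives an admissible input.
  have hcont : ∀ i k, 1 ≤ k → ∀ x, SupportedIn (Sx.column i k) x →
      ∃ u, SupportedIn (Su.column i k) u ∧
        SupportedIn (Sx.column i (k + 1)) (A *ᵥ x + B *ᵥ u) := by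
    intro i k hk ξ hξ
    obtain ⟨x, u, rfl, hstep, hxs, hus, -, -⟩ := (hfeas i).2 k hk ξ hξ
    exact ⟨u 0, hus 0, by rw [← hstep]; exact hxs 1⟩
  have hcontd : ∀ i x, SupportedIn (Sx.column i d) x → ∃ u, SupportedIn (Su.column i d) u ∧
      SupportedIn (Sx.column i d) (A *ᵥ x + B *ᵥ u) := fun i x hx => by
    have h := hcont i d hd x hx
    rwa [hsx i (d + 1) (by omega)] at h
  have hadm : ∀ i ξ, SupportedIn (Sx.column i d) ξ → ∃ x u, x 0 = ξ ∧
      IsTrajectory A B (fun _ => Sx.column i d) (fun _ => Su.column i d) x u ∧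
      Summable fun t => quadForm Q (x t) + quadForm R (u t) := by
    intro i ξ hξ
    obtain ⟨x, u, h0, hstep, hxs, hus, hx2, hu2⟩ := (hfeas i).2 d hd ξ hξ
    refine ⟨x, u, h0, ⟨hstep, fun t => ?_, fun t => ?_⟩,
      (summable_quadForm Q hx2).add (summable_quadForm R hu2)⟩
    · rw [← hsx i (d + t) (by omega)]
      exact hxs t
    · rw [← hsu i (d + t) (by omega)]
      exact hus t
  refine ⟨fun i => ?_, fun Xstar hX Φx Φu => ?_⟩
  · obtain ⟨X, hX⟩ := exists_isStationarySolution (Nstar i) hQ hR (hadm i)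
    exact ⟨X, hX, fun Y hY => hY.unique (Nstar i) hQ hR (hcontd i) hX⟩
  let 𝒜 := fun i => ASF A B Q R (Sx.column i) (Su.column i) d (N i) (Nstar i) (Xstar i)
  let 𝒦 := fun i => KSF A B Q R (Sx.column i) (Su.column i) d (N i) (Nstar i) (Xstar i)
  let Ψx : TransferMatrix (Fin n) (Fin n) :=
    Matrix.of fun a i => ssreal (𝒜 i) (BSF n d i) (CSF n d) 0 a ()
  let Ψu : TransferMatrix (Fin m) (Fin n) :=
    Matrix.of fun a i => ssreal (𝒜 i) (BSF n d i) (𝒦 i) 0 a ()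
  have hB := fun i => isBellman_column (N i) hQ hR (hsx i) (hsu i) hd (hcont i) (hX i)
  have hroots := fun i => norm_lt_one_of_charpoly_ASF (N i) hd hQ hR (hcontd i) (hX i)
  have hΨx : IsInvZRHInf Ψx := fun a i =>
    isInvZRHInf_ssreal (𝒜 i) (BSF n d i) (CSF n d) (hroots i) a ()
  have hΨu : IsInvZRHInf Ψu := fun a i =>
    isInvZRHInf_ssreal (𝒜 i) (BSF n d i) (𝒦 i) (hroots i) a ()
  let G := fun i => columnPolicy A Q R (N i) (Nstar i) (Xstar i)
  let x := fun i => feedbackState A B (G i) (Pi.single i 1)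
  have hlt : ∀ i t, t < d → x i (t + 1) =
      Acl A B Q R (Sx.column i) (Su.column i) d (N i) (Xstar i) (t + 1) *ᵥ x i t := by
    intro i t ht
    rw [Acl_mulVec]
    simp only [x, feedbackState]
    rw [show G i t = _ from if_pos ht]
  have hsupp : ∀ i, SupportedIn (Sx.column i (0 + 1)) (Pi.single i 1 : Fin n → ℝ) := fun i =>
    supportedIn_single (hfeas i).1
  have hge : ∀ i t, d ≤ t → x i (t + 1) =
      AclStar A B Q R (Sx.column i) (Su.column i) d (Nstar i) (Xstar i) *ᵥ x i t := by
    intro i t ht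
    have hs := ((hB i).isTrajectory_feedback (hsupp i)).supp_x t
    rw [show Sx.column i (t + 1) = _ from hsx i (t + 1) (by omega)] at hs
    rw [AclStar_mulVec hR (hcontd i) (hX i) hs]
    simp only [x, feedbackState]
    rw [show G i t = _ from if_neg ht.not_gt]
  have hpow := fun i t => ASF_pow_mul_BSF (Nstar := Nstar i) (N i) (x := x i) (i := i) rfl
    (hlt i) (hge i) t
  have hkx : ∀ i t, kernelColumn Ψx i t = x i t := by
    intro i t
    ext a
    have h := congrFun (congrFun (kernel_ssreal_succ (𝒜 i) (BSF n d i) (CSF n d) t) a) ()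
    rw [hpow, CSF_mul_blockState] at h
    exact h
  have hku : ∀ i t, kernelColumn Ψu i t = G i t *ᵥ x i t := by
    intro i t
    ext a
    have h := congrFun (congrFun (kernel_ssreal_succ (𝒜 i) (BSF n d i) (𝒦 i) t) a) ()
    rw [hpow, KSF_mul_blockState] at h
    exact h
  rw [isOptimal_iff_eq hQ hR (fun i => (hfeas i).1) hB hΨx hΨu hkx hku]
  constructor
  · rintro ⟨rfl, rfl⟩ i
    exact ⟨rfl, rfl⟩
  · intro h
    constructor
    · ext a i : 2
      exact congrFun (congrFun (h i).1 a) ()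
    · ext a i : 2
      exact congrFun (congrFun (h i).2 a) ()
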